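/- Let $n\ge 1$ and let $H=H(p,y):\mathbb{R}^n\times\mathbb{R}^n\to\mathbb{R}$ be convex in $p$ for every $y$, coercive in the sense that $\lim_{|p|\to\infty}\inf_{y\in\mathbb{R}^n}H(p,y)=+\infty$, and, for every $R>0$, uniformly continuous and bounded on $B_R\times\mathbb{R}^n$, where $B_R$ is the open ball of radius $R$ centred at $0$. Differential equations and inequalities are understood in the viscosity sense. For $p\in\mathbb{R}^n$ let $\overline H(p)$ be the infimum of all $\mu\in\mathbb{R}$ for which there is a Lipschitz function $w:\mathbb{R}^n\to\mathbb{R}$ with $H(p+Dw,y)\le\mu$ in $\mathbb{R}^n$ and $\lim_{|y|\to\infty}|y|^{-1}w(y)=0$. For $\mu>\min\overline H$ and $x_0\in\mathbb{R}^n$, a distance function at level $\mu$ with vertex $x_0$ is a function of the form $y\mapsto d'(y)+p_*\cdot(y-x_0)$, where $\overline H(p_*)=\min\overline H$ and $d'\in C(\mathbb{R}^n)$ solves $H(p_*+Dd',y)=\mu$ in $\mathbb{R}^n\setminus\{x_0\}$ with $d'(x_0)=0$ and $\liminf_{|y|\to\infty}|y|^{-1}d'(y)>0$. Write $V\Subset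 U$ if $V$ is open, $\overline V$ is compact and $\overline V\subseteq U$. Let $U\subseteq\mathbb{R}^n$ be open and let $u$ be an absolute subminimizer for $H$ in $U$: $u:U\to\mathbb{R}$ is locally Lipschitz, and for every $V\Subset U$ and every Lipschitz $v:\overline V\to\mathbb{R}$ with $v\le u$ in $V$ and $v=u$ on $\partial V$, $$\operatorname*{ess\,sup}_{x\in V}H(Du(x),x)\le\operatorname*{ess\,sup}_{x\in V}H(Dv(x),x).$$ Then for every $\mu>\min\overline H$ and $x_0\in\mathbb{R}^n$ there is exactly one distance function $d_{\mu,x_0}$ at level $\mu$ with vertex $x_0$, and $u$ satisfies comparisons with distance functions from above in $U$: for every $\mu>\min\overline H$, every nonempty $V\Subset U$ and every $x_0\in\mathbb{R}^n\setminus V$, $$\max_{x\in\overline V}\big(u(x)-d_{\mu,x_0}(x)\big)=\max_{x\in\partial V}\big(u(x)-d_{\mu,x_0}(x)\big).$$ -/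

import Mathlib

open Set Filter Topology MeasureTheory

noncomputable section

namespace LInfVar

/-- The Euclidean space `ℝⁿ` (Euclidean norm and inner product). -/
abbrev Space (n : ℕ) : Type := EuclideanSpace ℝ (Fin n)

variable {n : ℕ}

/-! ### Hypotheses on the Hamiltonian `H = H(p, y)` -/

/-- `p ↦ H(p, y)` is convex for every `y`. -/
def ConvexInMomentum (H : Space n → Space n → ℝ) : Prop :=
  ∀ y, ConvexOn ℝ univ fun p => H p y

/-- `inf_y H(p, y) → +∞` as `|p| → ∞`, i.e. for every `M` one has `inf_y H(p, y) ≥ M` as soon as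
`|p|` is large enough. -/
def CoerciveInMomentum (H : Space n → Space n → ℝ) : Prop :=
  ∀ M : ℝ, ∃ R : ℝ, ∀ p, R ≤ ‖p‖ → ∀ y, M ≤ H p y

/-- For every `R > 0`, `H` is uniformly continuous and bounded on `B_R × ℝⁿ`. -/
def UniformlyRegular (H : Space n → Space n → ℝ) : Prop :=
  ∀ R : ℝ, 0 < R →
    UniformContinuousOn (fun q : Space n × Space n => H q.1 q.2) (Metric.ball 0 R ×ˢ univ) ∧
    ∃ C : ℝ, ∀ p ∈ Metric.ball (0 : Space n) R, ∀ y, |H p y| ≤ C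

/-! ### Viscosity solutions of `F(Du, x) = μ` in an open set `O` -/

/-- `u` is a viscosity subsolution of `F(Du, x) ≤ μ` in the open set `O`. -/
def IsViscSubsolution (F : Space n → Space n → ℝ) (μ : ℝ) (O : Set (Space n))
    (u : Space n → ℝ) : Prop :=
  UpperSemicontinuousOn u O ∧
    ∀ φ : Space n → ℝ, ContDiff ℝ 1 φ → ∀ x ∈ O,
      IsLocalMax (fun y => u y - φ y) x → F (gradient φ x) x ≤ μ

/-- `u` is a viscosity supersolution of `F(Du, x) ≥ μ` in the open set `O`. -/
def IsViscSupersolution (F : Space n → Space n → ℝ) (μ : ℝ) (O : Set (Space n))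
    (u : Space n → ℝ) : Prop :=
  LowerSemicontinuousOn u O ∧
    ∀ φ : Space n → ℝ, ContDiff ℝ 1 φ → ∀ x ∈ O,
      IsLocalMin (fun y => u y - φ y) x → μ ≤ F (gradient φ x) x

/-- `u` is a viscosity solution of `F(Du, x) = μ` in the open set `O`. -/
def IsViscSolution (F : Space n → Space n → ℝ) (μ : ℝ) (O : Set (Space n))
    (u : Space n → ℝ) : Prop :=
  IsViscSubsolution F μ O u ∧ IsViscSupersolution F μ O u

/-! ### The effective Hamiltonian -/

/-- The levels `μ` for which `H(p + Dw, y) ≤ μ` has a global Lipschitz (viscosity) subsolution `w`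
that is strictly sublinear at infinity. -/
def subsolutionLevels (H : Space n → Space n → ℝ) (p : Space n) : Set ℝ :=
  {μ | ∃ w : Space n → ℝ, (∃ K, LipschitzWith K w) ∧
    IsViscSubsolution (fun q y => H (p + q) y) μ univ w ∧
    Tendsto (fun y => ‖y‖⁻¹ * w y) (cocompact (Space n)) (𝓝 0)}

/-- The effective Hamiltonian. -/
def effectiveH (H : Space n → Space n → ℝ) (p : Space n) : ℝ :=
  sInf (subsolutionLevels H p)

/-! ### Distance functions -/

/-- `d` is a (continuous, viscosity) solution of `H(p + Dd, y) = μ` in `ℝⁿ ∖ {x₀}` with `d(x₀) = 0`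
and `liminf_{|y| → ∞} d(y) / |y| > 0` (the liminf is taken in the extended reals). -/
def IsShiftedDistance (H : Space n → Space n → ℝ) (p : Space n) (μ : ℝ) (x₀ : Space n)
    (d : Space n → ℝ) : Prop :=
  Continuous d ∧ d x₀ = 0 ∧
    IsViscSolution (fun q y => H (p + q) y) μ {x₀}ᶜ d ∧
    (0 : EReal) < liminf (fun y => ((‖y‖⁻¹ * d y : ℝ) : EReal)) (cocompact (Space n))

/-- `d(y) = d'(y) + p_* · (y - x₀)`, where `p_*` is a minimum point of the effective Hamiltonian
and `d'` is the solution `IsShiftedDistance` for `p_*`. -/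
def IsDistanceFunction (H : Space n → Space n → ℝ) (μ : ℝ) (x₀ : Space n)
    (d : Space n → ℝ) : Prop :=
  ∃ pstar : Space n, (∀ p, effectiveH H pstar ≤ effectiveH H p) ∧
    ∃ d' : Space n → ℝ, IsShiftedDistance H pstar μ x₀ d' ∧
      ∀ y, d y = d' y + inner ℝ pstar (y - x₀)

/-- The distance function `d_{μ,x₀}`: the function satisfying `IsDistanceFunction H μ x₀`. -/
def distanceFunction (H : Space n → Space n → ℝ) (μ : ℝ) (x₀ : Space n) : Space n → ℝ :=
  Classical.epsilon (IsDistanceFunction H μ x₀)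

/-! ### Absolute subminimizers and comparison with distance functions -/

/-- `V` is open and compactly contained in `U`. -/
def CompactlyInside (V U : Set (Space n)) : Prop :=
  IsOpen V ∧ IsCompact (closure V) ∧ closure V ⊆ U

/-- `ess sup_{x ∈ V} H(Du(x), x)`, as an extended real number. By Rademacher's theorem `Du` exists
almost everywhere for the locally Lipschitz functions it is used for. -/
def energy (H : Space n → Space n → ℝ) (V : Set (Space n)) (u : Space n → ℝ) : EReal :=
  essSup (fun x => (H (gradient u x) x : EReal)) (volume.restrict V)

/-- `u` is absolutely subminimizing for `H` in `U`. -/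
def IsAbsSubminimizer (H : Space n → Space n → ℝ) (U : Set (Space n)) (u : Space n → ℝ) : Prop :=
  LocallyLipschitzOn U u ∧
    ∀ V, CompactlyInside V U → ∀ v : Space n → ℝ, (∃ K, LipschitzOnWith K v (closure V)) →
      (∀ x ∈ V, v x ≤ u x) → (∀ x ∈ frontier V, v x = u x) →
      energy H V u ≤ energy H V v

/-- `u` satisfies comparisons with distance functions from above with respect to `H` in `U`:
`u - d_{μ,x₀}` has a maximum over `closure V` and one over `∂V`, and the two are equal. -/
def ComparisonFromAbove (H : Space n → Space n → ℝ) (U : Set (Space n))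
    (u : Space n → ℝ) : Prop :=
  ∀ μ : ℝ, (⨅ p, effectiveH H p) < μ → ∀ V, CompactlyInside V U → V.Nonempty → ∀ x₀ ∉ V,
    ∃ m : ℝ, IsGreatest ((fun x => u x - distanceFunction H μ x₀ x) '' closure V) m ∧
      IsGreatest ((fun x => u x - distanceFunction H μ x₀ x) '' frontier V) m

end LInfVar

end

/-!
Coercivity makes subsolutions Lipschitz, so that they satisfy the equation almost everywhere, and
convexity then allows them to be combined and mollified. A subsolution `z` at the critical level `μ`
is compared with a supersolution `d` by moving it slightly towards a subsolution `s` of a level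
`μ₀ < μ`: the combination is strict, and, since `d` grows faster than `s`, it stays below `d` near
infinity. If it exceeded `d` somewhere but not on the boundary, then a mollification of it, shifted
by a constant, would touch `d` from below, which the supersolution property forbids.

The largest subsolution vanishing at `x₀` is a distance function by Perron's method; it grows
faster than the affine function of slope `p_*` because subsolutions with slopes close to `p_*`
compete in the supremum. Comparison gives uniqueness. If `u - d` exceeded its maximum over `∂V`
inside `V`, say by passing a level `k`, then subminimality on `{u > d + k}` against `d + k` would
make `u` an almost everywhere subsolution there, contradicting comparison.
-/

noncomputable section

namespace LInfVar

/-! ### Gradients -/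

section Gradient

variable {E : Type*} [NormedAddCommGroup E] [InnerProductSpace ℝ E] {f g : E → ℝ}
  {a b x x₀ : E}

theorem contDiff_inner_sub (p x₀ : E) : ContDiff ℝ 1 fun y => inner ℝ p (y - x₀) :=
  contDiff_const.inner ℝ (contDiff_id.sub contDiff_const)

variable [CompleteSpace E]

theorem hasGradientAt_add (hf : HasGradientAt f a x) (hg : HasGradientAt g b x) :
    HasGradientAt (fun y => f y + g y) (a + b) x := by
  rw [hasGradientAt_iff_hasFDerivAt] at *
  simpa only [map_add] using hf.fun_add hg

theorem hasGradientAt_const_mul (hf : HasGradientAt f a x) (c : ℝ) :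
    HasGradientAt (fun y => c * f y) (c • a) x := by
  rw [hasGradientAt_iff_hasFDerivAt] at *
  simpa using hf.const_mul c

theorem hasGradientAt_sub (hf : HasGradientAt f a x) (hg : HasGradientAt g b x) :
    HasGradientAt (fun y => f y - g y) (a - b) x := by
  rw [hasGradientAt_iff_hasFDerivAt] at *
  simpa only [map_sub] using hf.fun_sub hg

theorem hasGradientAt_add_const (hf : HasGradientAt f a x) (c : ℝ) :
    HasGradientAt (fun y => f y + c) a x := by
  simpa using hasGradientAt_add hf (hasGradientAt_const x c)

theorem hasGradientAt_inner_sub (p x₀ x : E) :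
    HasGradientAt (fun y => inner ℝ p (y - x₀)) p x :=
  ((innerSL ℝ p).hasFDerivAt.comp x ((hasFDerivAt_id x).sub_const x₀)).congr_fderiv
    (by ext v; simp)

theorem hasGradientAt_norm_sub_sq (x₀ x : E) :
    HasGradientAt (fun y => ‖y - x₀‖ ^ 2) ((2 : ℝ) • (x - x₀)) x :=
  (((hasFDerivAt_id x).sub_const x₀).norm_sq).congr_fderiv (by ext v; simp)

theorem hasGradientAt_norm_sub (h : x ≠ x₀) :
    HasGradientAt (fun y => ‖y - x₀‖) (‖x - x₀‖⁻¹ • (x - x₀)) x := by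
  have hpos : 0 < ‖x - x₀‖ := norm_pos_iff.2 (sub_ne_zero.2 h)
  have hsqrt := (hasGradientAt_norm_sub_sq x₀ x).hasFDerivAt.sqrt (by positivity)
  simp only [Real.sqrt_sq (norm_nonneg _)] at hsqrt
  refine hsqrt.congr_fderiv ?_
  rw [map_smul, map_smul, smul_smul]
  congr 1
  field_simp

theorem norm_gradient_mul_norm_sub_add_mul_sq {K A : ℝ} (hK : 0 ≤ K) (hA : 0 ≤ A) (h : x ≠ x₀) :
    ‖gradient (fun y => K * ‖y - x₀‖ + A * ‖y - x₀‖ ^ 2) x‖ = K + 2 * A * ‖x - x₀‖ := by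
  have hpos : 0 < ‖x - x₀‖ := norm_pos_iff.2 (sub_ne_zero.2 h)
  rw [(hasGradientAt_add (hasGradientAt_const_mul (hasGradientAt_norm_sub h) K)
    (hasGradientAt_const_mul (hasGradientAt_norm_sub_sq x₀ x) A)).gradient,
    smul_smul, smul_smul, ← add_smul, norm_smul, Real.norm_of_nonneg (by positivity)]
  field_simp

theorem gradient_eq_of_isLocalMax_sub (hf : DifferentiableAt ℝ f x) (hg : DifferentiableAt ℝ g x)
    (h : IsLocalMax (fun y => f y - g y) x) : gradient f x = gradient g x :=
  sub_eq_zero.1 <| (InnerProductSpace.toDual ℝ E).map_eq_zero_iff.1 <|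
    h.hasFDerivAt_eq_zero (hasGradientAt_sub hf.hasGradientAt hg.hasGradientAt).hasFDerivAt

theorem norm_gradient_le_of_lipschitzWith {K : NNReal} (hf : LipschitzWith K f) (x : E) :
    ‖gradient f x‖ ≤ K := by
  rw [gradient, LinearIsometryEquiv.norm_map]
  exact norm_fderiv_le_of_lipschitz ℝ hf

theorem continuous_gradient_of_contDiff (hf : ContDiff ℝ 1 f) : Continuous (gradient f) :=
  (InnerProductSpace.toDual ℝ E).symm.continuous.comp (hf.continuous_fderiv one_ne_zero)

end Gradient

theorem exists_contDiff_eventuallyEq {E F : Type*} [NormedAddCommGroup E] [NormedSpace ℝ E]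
    [HasContDiffBump E] [NormedAddCommGroup F] [NormedSpace ℝ F] {n : ℕ} {f : E → F} {x : E}
    (hf : ContDiffAt ℝ n f x) : ∃ φ : E → F, ContDiff ℝ n φ ∧ φ =ᶠ[𝓝 x] f := by
  obtain ⟨ρ, hρ, hball⟩ := Metric.eventually_nhds_iff_ball.1 (hf.eventually (by simp))
  let χ : ContDiffBump x := ⟨ρ / 3, ρ / 2, by positivity, by linarith⟩
  refine ⟨fun y => χ y • f y, contDiff_iff_contDiffAt.2 fun y => ?_, ?_⟩
  · by_cases hy : y ∈ Metric.ball x ρ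
    · exact χ.contDiffAt.smul (hball y hy)
    · have hy' : y ∉ tsupport χ := by
        rw [χ.tsupport_eq]
        exact fun h => hy (Metric.closedBall_subset_ball (half_lt_self hρ) h)
      refine (contDiffAt_const (c := (0 : F))).congr_of_eventuallyEq ?_
      filter_upwards [notMem_tsupport_iff_eventuallyEq.1 hy'] with z hz
      simp [hz]
  · filter_upwards [χ.eventuallyEq_one] with z hz
    simp [hz]

/-! ### Averages of Lipschitz functions -/

section Averaging

variable {E : Type*} [MeasurableSpace E] {μ ν : Measure E}

theorem ae_sub_left_of_ae [AddGroup E] [MeasurableAdd₂ E] [MeasurableNeg E] [SFinite μ]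
    [μ.IsAddLeftInvariant] (hν : ν ≪ μ) {P : E → Prop} (hP : ∀ᵐ x ∂μ, P x) (y : E) :
    ∀ᵐ t ∂ν, P (y - t) :=
  hν.ae_le ((quasiMeasurePreserving_sub_left μ y).ae hP)

variable [NormedAddCommGroup E] [BorelSpace E] {K : NNReal} {z : E → ℝ} {ρ : ℝ}

theorem integrable_comp_sub_of_lipschitzWith [IsFiniteMeasure ν]
    (hz : LipschitzWith K z) (hρ : ∀ᵐ t ∂ν, ‖t‖ ≤ ρ) (y : E) :
    Integrable (fun t => z (y - t)) ν := by
  refine .of_bound (hz.continuous.comp (continuous_sub_left y)).aestronglyMeasurable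
    (‖z y‖ + K * ρ) ?_
  filter_upwards [hρ] with t ht
  calc ‖z (y - t)‖ ≤ ‖z y‖ + ‖z (y - t) - z y‖ := norm_le_norm_add_norm_sub' _ _
    _ ≤ ‖z y‖ + K * ‖y - t - y‖ := by gcongr; exact hz.norm_sub_le _ _
    _ ≤ ‖z y‖ + K * ρ := by rw [sub_sub_cancel_left, norm_neg]; gcongr

section Derivative

variable [NormedSpace ℝ E] [FiniteDimensional ℝ E] [μ.IsAddHaarMeasure] [IsFiniteMeasure ν]

theorem hasFDerivAt_integral_comp_sub (hz : LipschitzWith K z) (hν : ν ≪ μ)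
    (hρ : ∀ᵐ t ∂ν, ‖t‖ ≤ ρ) (y : E) :
    Integrable (fun t => fderiv ℝ z (y - t)) ν ∧
      HasFDerivAt (fun x => ∫ t, z (x - t) ∂ν) (∫ t, fderiv ℝ z (y - t) ∂ν) y := by
  refine hasFDerivAt_integral_of_dominated_loc_of_lip univ_mem
    (.of_forall fun x => (integrable_comp_sub_of_lipschitzWith hz hρ x).aestronglyMeasurable)
    (integrable_comp_sub_of_lipschitzWith hz hρ y)
    ((measurable_fderiv ℝ z).comp (measurable_id.const_sub y)).aestronglyMeasurable
    (ae_of_all _ fun t => ?_) (integrable_const (K : ℝ)) ?_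
  · rw [Real.nnabs_coe]
    exact (LipschitzWith.of_dist_le_mul fun a b => by
      simpa using hz.dist_le_mul (a - t) (b - t)).lipschitzOnWith
  · filter_upwards [ae_sub_left_of_ae hν (hz.ae_differentiableAt (μ := μ)) y] with t ht
    exact (ht.hasFDerivAt.comp y ((hasFDerivAt_id y).sub_const t)).congr_fderiv (by ext v; simp)

end Derivative

theorem gradient_integral_comp_sub_mem [InnerProductSpace ℝ E] [FiniteDimensional ℝ E]
    [μ.IsAddHaarMeasure] [IsProbabilityMeasure ν] (hz : LipschitzWith K z) (hν : ν ≪ μ)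
    (hρ : ∀ᵐ t ∂ν, ‖t‖ ≤ ρ) {C : Set E} (hconv : Convex ℝ C) (hclosed : IsClosed C) {y : E}
    (hy : ∀ᵐ t ∂ν, gradient z (y - t) ∈ C) : gradient (fun x => ∫ t, z (x - t) ∂ν) y ∈ C := by
  obtain ⟨hint, hderiv⟩ := hasFDerivAt_integral_comp_sub hz hν hρ y
  rw [gradient, hderiv.fderiv]
  let D := (InnerProductSpace.toDual ℝ E).symm
  exact (hconv.is_linear_preimage ⟨D.map_add, fun c L => by simp⟩).integral_mem
    (hclosed.preimage D.continuous) hy hint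

end Averaging

section Mollifier

variable {E : Type*} [NormedAddCommGroup E] [NormedSpace ℝ E] [FiniteDimensional ℝ E]
  [MeasurableSpace E]

/-- The probability measure whose density is a normalized smooth bump: averaging against it is the
mollification by that bump, in a form to which Jensen's inequality applies. -/
def mollifierMeasure (χ : ContDiffBump (0 : E)) (μ : Measure E) : Measure E :=
  μ.withDensity fun t => ENNReal.ofReal (χ.normed μ t)

variable (χ : ContDiffBump (0 : E)) (μ : Measure E)

theorem mollifierMeasure_absolutelyContinuous : mollifierMeasure χ μ ≪ μ :=
  withDensity_absolutelyContinuous _ _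

variable [BorelSpace E]

theorem measurable_ofReal_normed : Measurable fun t => ENNReal.ofReal (χ.normed μ t) :=
  χ.continuous_normed.measurable.ennreal_ofReal

theorem ae_mollifierMeasure_norm_lt : ∀ᵐ t ∂mollifierMeasure χ μ, ‖t‖ < χ.rOut := by
  refine (ae_withDensity_iff (measurable_ofReal_normed χ μ)).2 (ae_of_all _ fun t ht => ?_)
  by_contra! hle
  exact ht (by rw [χ.normed_def, χ.zero_of_le_dist (by simpa using hle)]; simp)

instance isProbabilityMeasure_mollifierMeasure [IsLocallyFiniteMeasure μ] [μ.IsOpenPosMeasure] :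
    IsProbabilityMeasure (mollifierMeasure χ μ) where
  measure_univ := by
    rw [mollifierMeasure, withDensity_apply _ .univ, Measure.restrict_univ,
      ← ofReal_integral_eq_lintegral_ofReal χ.integrable_normed (ae_of_all _ χ.nonneg_normed),
      χ.integral_normed, ENNReal.ofReal_one]

theorem integral_mollifierMeasure_comp_sub (z : E → ℝ) :
    (fun y => ∫ t, z (y - t) ∂mollifierMeasure χ μ) =
      convolution (χ.normed μ) z (ContinuousLinearMap.lsmul ℝ ℝ) μ := by
  funext y
  rw [mollifierMeasure, integral_withDensity_eq_integral_toReal_smul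
    (measurable_ofReal_normed χ μ) (ae_of_all _ fun _ => ENNReal.ofReal_lt_top)]
  simp only [ENNReal.toReal_ofReal (χ.nonneg_normed _)]
  rfl

theorem contDiff_integral_mollifierMeasure [μ.IsAddHaarMeasure] {z : E → ℝ} (hz : Continuous z)
    {n : ℕ} : ContDiff ℝ n fun y => ∫ t, z (y - t) ∂mollifierMeasure χ μ := by
  rw [integral_mollifierMeasure_comp_sub]
  exact χ.hasCompactSupport_normed.contDiff_convolution_left _ χ.contDiff_normed
    hz.locallyIntegrable

theorem abs_integral_mollifierMeasure_sub_le [μ.IsAddHaarMeasure] {z : E → ℝ} {K : NNReal}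
    (hz : LipschitzWith K z) (y : E) :
    |∫ t, z (y - t) ∂mollifierMeasure χ μ - z y| ≤ K * χ.rOut := by
  rw [← Real.dist_eq, congrFun (integral_mollifierMeasure_comp_sub χ μ z) y]
  refine χ.dist_normed_convolution_le hz.continuous.aestronglyMeasurable fun x hx => ?_
  exact (hz.dist_le_mul x y).trans (by gcongr; exact (Metric.mem_ball.1 hx).le)

end Mollifier

/-! ### Touching points -/

theorem exists_isMaxOn_closedBall_of_lt_sphere {X β : Type*} [PseudoMetricSpace X] [ProperSpace X]
    [LinearOrder β] {f : X → β} {x : X} {r : ℝ} (hr : 0 ≤ r)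
    (hf : UpperSemicontinuousOn f (Metric.closedBall x r))
    (hlt : ∀ y ∈ Metric.sphere x r, f y < f x) :
    ∃ y ∈ Metric.ball x r, IsMaxOn f (Metric.closedBall x r) y := by
  have hx : x ∈ Metric.closedBall x r := Metric.mem_closedBall_self hr
  obtain ⟨y, hy, hmax⟩ := hf.exists_isMaxOn ⟨x, hx⟩ (isCompact_closedBall x r)
  exact ⟨y, lt_of_le_of_ne hy fun h => (hlt y h).not_ge (hmax hx), hmax⟩

theorem le_of_forall_exists_dist_lt {X Y : Type*} [PseudoMetricSpace X] [PseudoMetricSpace Y]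
    {F : X → Y → ℝ} (hF : Continuous fun q : X × Y => F q.1 q.2) {μ : ℝ} {p : X} {x : Y}
    (h : ∀ ε > 0, ∃ q y, dist p q < ε ∧ dist x y < ε ∧ F q y ≤ μ) : F p x ≤ μ := by
  have hmem : (p, x) ∈ closure {q : X × Y | F q.1 q.2 ≤ μ} :=
    Metric.mem_closure_iff.2 fun ε hε => by
      obtain ⟨q, y, hq, hy, hle⟩ := h ε hε
      exact ⟨(q, y), hle, max_lt hq hy⟩
  exact (isClosed_le hF continuous_const).closure_subset hmem

variable {n : ℕ}

section Viscosity

variable {F G : Space n → Space n → ℝ} {μ ν : ℝ} {O O' : Set (Space n)} {u φ ψ : Space n → ℝ}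
  {x x₀ p : Space n} {r : ℝ}

namespace IsViscSubsolution

theorem mono (hu : IsViscSubsolution F μ O u) (h : O' ⊆ O) : IsViscSubsolution F μ O' u :=
  ⟨hu.1.mono h, fun φ hφ x hx => hu.2 φ hφ x (h hx)⟩

theorem imp (hu : IsViscSubsolution F μ O u) (h : ∀ q, ∀ y ∈ O, F q y ≤ μ → G q y ≤ ν) :
    IsViscSubsolution G ν O u :=
  ⟨hu.1, fun φ hφ x hx hmax => h _ x hx (hu.2 φ hφ x hx hmax)⟩

theorem add_contDiff (hu : IsViscSubsolution F μ O u) (hψ : ContDiff ℝ 1 ψ) :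
    IsViscSubsolution (fun q y => F (q - gradient ψ y) y) μ O fun y => u y + ψ y := by
  refine ⟨hu.1.add hψ.continuous.continuousOn.upperSemicontinuousOn, fun φ hφ x hx hmax => ?_⟩
  have h := hu.2 _ (hφ.sub hψ) x hx (by simpa only [← sub_sub_eq_add_sub, sub_sub] using hmax)
  rwa [(hasGradientAt_sub (hφ.differentiable one_ne_zero x).hasGradientAt
    (hψ.differentiable one_ne_zero x).hasGradientAt).gradient] at h

theorem le_of_contDiffAt (hu : IsViscSubsolution F μ O u) (hψ : ContDiffAt ℝ 1 ψ x) (hx : x ∈ O)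
    (hmax : IsLocalMax (fun y => u y - ψ y) x) : F (gradient ψ x) x ≤ μ := by
  obtain ⟨φ, hφ, heq⟩ := exists_contDiff_eventuallyEq (n := 1) (mod_cast hψ)
  rw [← heq.gradient_eq]
  exact hu.2 φ (mod_cast hφ) x hx (hmax.congr (heq.mono fun y hy => by simp only [hy]))

theorem exists_mem_ball_add_smul_le (hu : IsViscSubsolution F μ O u) (hψ : ContDiff ℝ 1 ψ)
    (hr : 0 ≤ r) (hO : Metric.closedBall x r ⊆ O) {A : ℝ}
    (hlt : ∀ y ∈ Metric.sphere x r, u y - ψ y < u x - ψ x + A * r ^ 2) :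
    ∃ y ∈ Metric.ball x r, F (gradient ψ y + (2 * A) • (y - x)) y ≤ μ := by
  have hφ : ContDiff ℝ 1 fun y => ψ y + A * ‖y - x‖ ^ 2 :=
    hψ.add (contDiff_const.mul ((contDiff_id.sub contDiff_const).norm_sq ℝ))
  obtain ⟨y, hy, hmax⟩ := exists_isMaxOn_closedBall_of_lt_sphere
    (f := fun y => u y + -(ψ y + A * ‖y - x‖ ^ 2)) hr
    ((hu.1.mono hO).add hφ.continuous.neg.continuousOn.upperSemicontinuousOn) fun y hy => by
      have := hlt y hy
      simp only [mem_sphere_iff_norm.1 hy, sub_self, norm_zero]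
      linarith
  simp only [← sub_eq_add_neg] at hmax
  refine ⟨y, hy, ?_⟩
  have h := hu.2 _ hφ y (hO (Metric.ball_subset_closedBall hy))
    (hmax.isLocalMax (Metric.closedBall_mem_nhds_of_mem hy))
  rwa [(hasGradientAt_add (hψ.differentiable one_ne_zero y).hasGradientAt
    (hasGradientAt_const_mul (hasGradientAt_norm_sub_sq x y) A)).gradient, smul_smul,
    mul_comm A] at h

theorem le_of_differentiableAt (hu : IsViscSubsolution F μ O u) (hO : IsOpen O)
    (hF : Continuous fun q : Space n × Space n => F q.1 q.2) (hx : x ∈ O)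
    (hd : DifferentiableAt ℝ u x) : F (gradient u x) x ≤ μ := by
  refine le_of_forall_exists_dist_lt hF fun ε hε => ?_
  have hexp := (hasGradientAt_iff_isLittleO.1 hd.hasGradientAt).def (show 0 < ε / 8 by positivity)
  obtain ⟨r, hr, hball⟩ := Metric.nhds_basis_closedBall.eventually_iff.1
    ((hexp.and (hO.mem_nhds hx)).and (Metric.closedBall_mem_nhds x (half_pos hε)))
  obtain ⟨y, hy, hle⟩ := hu.exists_mem_ball_add_smul_le (A := ε / 4 / r)
    (ψ := fun y => inner ℝ (gradient u x) (y - x)) (contDiff_inner_sub _ x) hr.le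
    (fun y hy => (hball hy).1.2) fun y hy => by
      have hsphere := (abs_le.1 (hball (Metric.sphere_subset_closedBall hy)).1.1).2
      have : 0 < ε * r := by positivity
      rw [mem_sphere_iff_norm.1 hy] at hsphere
      rw [sub_self, inner_zero_right, show ε / 4 / r * r ^ 2 = ε / 4 * r by field_simp]
      linarith
  rw [(hasGradientAt_inner_sub (gradient u x) x y).gradient] at hle
  refine ⟨_, y, ?_, ?_, hle⟩
  · rw [dist_self_add_right, norm_smul, Real.norm_of_nonneg (by positivity)]
    calc 2 * (ε / 4 / r) * ‖y - x‖ ≤ 2 * (ε / 4 / r) * r := by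
          gcongr; exact (mem_ball_iff_norm.1 hy).le
      _ < ε := by field_simp; linarith
  · have hyx : dist y x ≤ ε / 2 := (hball (Metric.ball_subset_closedBall hy)).2
    rw [dist_comm]
    exact hyx.trans_lt (half_lt_self hε)

theorem of_isLUB {S : Set (Space n → ℝ)} (hS : ∀ w ∈ S, IsViscSubsolution F μ O w)
    (hO : IsOpen O) (hF : Continuous fun q : Space n × Space n => F q.1 q.2)
    (husc : UpperSemicontinuousOn u O) (hlub : ∀ y, IsLUB ((fun w => w y) '' S) (u y)) :
    IsViscSubsolution F μ O u := by
  refine ⟨husc, fun φ hφ x hx hmax => le_of_forall_exists_dist_lt hF fun ε hε => ?_⟩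
  have hgrad : ∀ᶠ y in 𝓝 x, gradient φ y ∈ Metric.ball (gradient φ x) (ε / 2) :=
    (continuous_gradient_of_contDiff hφ).continuousAt (Metric.ball_mem_nhds _ (half_pos hε))
  have hsmall : Metric.ball x (ε / 4) ∈ 𝓝 x := Metric.ball_mem_nhds x (by positivity)
  obtain ⟨r, hr, hball⟩ := Metric.nhds_basis_closedBall.eventually_iff.1
    ((hgrad.and (hO.mem_nhds hx)).and (hmax.and hsmall))
  obtain ⟨_, ⟨w, hw, rfl⟩, hwx, -⟩ := (hlub x).exists_between (sub_lt_self (u x) (sq_pos_of_pos hr))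
  obtain ⟨y, hy, hle⟩ := (hS w hw).exists_mem_ball_add_smul_le (A := 1) hφ hr.le
    (fun y hy => (hball hy).1.2) fun y hy => by
      have hmax' := (hball (Metric.sphere_subset_closedBall hy)).2.1
      have := (hlub y).1 (mem_image_of_mem _ hw)
      simp only at hwx hmax' this ⊢
      linarith
  have hyr := hball (Metric.ball_subset_closedBall hy)
  have hyx : dist y x < ε / 4 := hyr.2.2
  refine ⟨_, y, ?_, by rw [dist_comm]; linarith [hyx], hle⟩
  have hgy : dist (gradient φ x) (gradient φ y) < ε / 2 := by rw [dist_comm]; exact hyr.1.1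
  refine (dist_triangle _ (gradient φ y) _).trans_lt ?_
  rw [dist_self_add_right, norm_smul, Real.norm_of_nonneg (by norm_num), ← dist_eq_norm]
  linarith

end IsViscSubsolution

theorem IsViscSupersolution.mono (hu : IsViscSupersolution F μ O u) (h : O' ⊆ O) :
    IsViscSupersolution F μ O' u :=
  ⟨hu.1.mono h, fun φ hφ x hx => hu.2 φ hφ x (h hx)⟩

theorem IsViscSupersolution.add_contDiff (hu : IsViscSupersolution F μ O u)
    (hψ : ContDiff ℝ 1 ψ) :
    IsViscSupersolution (fun q y => F (q - gradient ψ y) y) μ O fun y => u y + ψ y := by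
  refine ⟨hu.1.add hψ.continuous.continuousOn.lowerSemicontinuousOn, fun φ hφ x hx hmin => ?_⟩
  have h := hu.2 _ (hφ.sub hψ) x hx (by simpa only [← sub_sub_eq_add_sub, sub_sub] using hmin)
  rwa [(hasGradientAt_sub (hφ.differentiable one_ne_zero x).hasGradientAt
    (hψ.differentiable one_ne_zero x).hasGradientAt).gradient] at h

end Viscosity

/-! ### Lipschitz continuity of subsolutions -/

theorem lipschitzWith_of_local_bound {E : Type*} [NormedAddCommGroup E] [NormedSpace ℝ E]
    {u : E → ℝ} (hu : Continuous u) {K : NNReal}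
    (h : ∀ x, ∀ K' : ℝ, K < K' → ∃ A : ℝ, ∀ᶠ y in 𝓝 x,
      u y ≤ u x + K' * ‖y - x‖ + A * ‖y - x‖ ^ 2) : LipschitzWith K u := by
  refine LipschitzWith.of_le_add_mul K fun y x => ?_
  rcases eq_or_ne y x with rfl | hyx
  · simp
  have hpos : 0 < ‖y - x‖ := norm_pos_iff.2 (sub_ne_zero.2 hyx)
  have hγ : Continuous (AffineMap.lineMap x y : ℝ → E) := AffineMap.lineMap_continuous
  -- It suffices to bound the right slopes of `u` along the segment from `x` to `y`.
  have hbound := image_le_of_liminf_slope_right_le_deriv_boundary (a := 0) (b := 1)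
    (f := fun t : ℝ => u (AffineMap.lineMap x y t)) (hu.comp hγ).continuousOn
    (B := fun t => u x + K * ‖y - x‖ * t) (B' := fun _ => K * ‖y - x‖)
    (by simp) (by fun_prop) (fun t _ => by
      simpa using (((hasDerivAt_id t).const_mul (K * ‖y - x‖)).const_add (u x)).hasDerivWithinAt)
    ?_ (right_mem_Icc.2 zero_le_one)
  · simpa [dist_eq_norm] using hbound
  intro t _ r hr
  obtain ⟨s, hs, hsr⟩ := exists_between hr
  obtain ⟨A, hA⟩ := h (AffineMap.lineMap x y t) (s / ‖y - x‖) (by rwa [lt_div_iff₀ hpos])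
  have hslope : ∀ᶠ τ in 𝓝 t, s + A * ((τ - t) * ‖y - x‖ ^ 2) < r :=
    (Continuous.tendsto (by fun_prop) t).eventually (gt_mem_nhds (by simpa using hsr))
  refine Eventually.frequently ?_
  filter_upwards [nhdsWithin_le_nhds (hγ.continuousAt.eventually hA), nhdsWithin_le_nhds hslope,
    self_mem_nhdsWithin] with τ hτ hτr hlt
  have htτ : 0 < τ - t := sub_pos.2 hlt
  have hnorm : ‖AffineMap.lineMap x y τ - AffineMap.lineMap x y t‖ = (τ - t) * ‖y - x‖ := by
    rw [← dist_eq_norm, dist_lineMap_lineMap, Real.dist_eq, abs_of_pos htτ, dist_comm,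
      dist_eq_norm]
  rw [hnorm] at hτ
  rw [slope_def_field, div_lt_iff₀ htτ]
  calc u (AffineMap.lineMap x y τ) - u (AffineMap.lineMap x y t)
      ≤ s / ‖y - x‖ * ((τ - t) * ‖y - x‖) + A * ((τ - t) * ‖y - x‖) ^ 2 := by linarith
    _ = (s + A * ((τ - t) * ‖y - x‖ ^ 2)) * (τ - t) := by field_simp
    _ < r * (τ - t) := by gcongr

section Lipschitz

variable {F : Space n → Space n → ℝ} {μ : ℝ} {O : Set (Space n)} {u : Space n → ℝ} {K : NNReal}

theorem IsViscSubsolution.eq_center_of_isMaxOn_sub_cone (hu : IsViscSubsolution F μ O u)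
    (hF : ∀ p y, F p y ≤ μ → ‖p‖ ≤ K) {K' A : ℝ} (hK' : K < K') (hA : 0 ≤ A) {x y : Space n}
    (hy : y ≠ x → y ∈ O)
    (hmax : IsLocalMax (fun y => u y - (K' * ‖y - x‖ + A * ‖y - x‖ ^ 2)) y) : y = x := by
  by_contra hyx
  have hnorm : ContDiffAt ℝ 1 (fun y => ‖y - x‖) y :=
    (contDiffAt_id.sub contDiffAt_const).norm ℝ (sub_ne_zero.2 hyx)
  have hle := hF _ _ (hu.le_of_contDiffAt
    ((contDiffAt_const.mul hnorm).add (contDiffAt_const.mul (hnorm.pow 2))) (hy hyx) hmax)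
  rw [norm_gradient_mul_norm_sub_add_mul_sq (K.2.trans hK'.le) hA hyx] at hle
  have : 0 ≤ 2 * A * ‖y - x‖ := by positivity
  linarith

theorem IsViscSubsolution.exists_le_cone (hu : IsViscSubsolution F μ O u) (hcont : Continuous u)
    (hF : ∀ p y, F p y ≤ μ → ‖p‖ ≤ K) {K' : ℝ} (hK' : K < K') {x : Space n} (hx : O ∈ 𝓝[≠] x) :
    ∃ A : ℝ, ∀ᶠ y in 𝓝 x, u y ≤ u x + K' * ‖y - x‖ + A * ‖y - x‖ ^ 2 := by
  obtain ⟨r, hr, hrO⟩ := Metric.mem_nhdsWithin_iff.1 hx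
  obtain ⟨M, hM⟩ := (isCompact_closedBall x r).bddAbove_image hcont.continuousOn
  have hK'0 : 0 < K' := K.2.trans_lt hK'
  have hA : |M - u x| / r ^ 2 * r ^ 2 = |M - u x| := div_mul_cancel₀ _ (by positivity)
  obtain ⟨y, hy, hmax⟩ := exists_isMaxOn_closedBall_of_lt_sphere
    (f := fun y => u y - (K' * ‖y - x‖ + |M - u x| / r ^ 2 * ‖y - x‖ ^ 2)) hr.le
    (Continuous.upperSemicontinuous (by fun_prop) |>.upperSemicontinuousOn _) fun y hy => by
      have hyM := hM (mem_image_of_mem u (Metric.sphere_subset_closedBall hy))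
      have : 0 < K' * r := by positivity
      simp only [mem_sphere_iff_norm.1 hy, hA, sub_self, norm_zero]
      linarith [le_abs_self (M - u x)]
  obtain rfl := hu.eq_center_of_isMaxOn_sub_cone hF hK' (by positivity)
    (fun hyx => hrO ⟨hy, hyx⟩) (hmax.isLocalMax (Metric.closedBall_mem_nhds_of_mem hy))
  refine ⟨|M - u y| / r ^ 2, ?_⟩
  filter_upwards [Metric.closedBall_mem_nhds y hr] with z hz
  have := hmax hz
  simp only [sub_self, norm_zero, mem_ofPred_eq] at this
  linarith

theorem IsViscSubsolution.lipschitzWith (hu : IsViscSubsolution F μ O u) (hcont : Continuous u)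
    (hF : ∀ p y, F p y ≤ μ → ‖p‖ ≤ K) (hO : ∀ x, O ∈ 𝓝[≠] x) : LipschitzWith K u :=
  lipschitzWith_of_local_bound hcont fun x _ hK' => hu.exists_le_cone hcont hF hK' (hO x)

end Lipschitz

theorem compl_singleton_mem_nhdsNE {X : Type*} [TopologicalSpace X] [T1Space X] (x₀ x : X) :
    {x₀}ᶜ ∈ 𝓝[≠] x :=
  nhdsNE_le_cofinite x (finite_singleton x₀).compl_mem_cofinite

/-! ### Consequences of coercivity and regularity -/

variable {H : Space n → Space n → ℝ}

theorem CoerciveInMomentum.exists_norm_le (hcoer : CoerciveInMomentum H) (μ : ℝ) :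
    ∃ K : NNReal, ∀ p y, H p y ≤ μ → ‖p‖ ≤ K := by
  obtain ⟨R, hR⟩ := hcoer (μ + 1)
  refine ⟨R.toNNReal, fun p y hp => ?_⟩
  by_contra! hlt
  have := hR p ((Real.le_coe_toNNReal R).trans hlt.le) y
  linarith

theorem CoerciveInMomentum.exists_forall_le (hcoer : CoerciveInMomentum H)
    (hreg : UniformlyRegular H) : ∃ M : ℝ, ∀ q y, M ≤ H q y := by
  obtain ⟨R, hR⟩ := hcoer 0
  obtain ⟨C, hC⟩ := (hreg (|R| + 1) (by positivity)).2
  refine ⟨min 0 (-C), fun q y => ?_⟩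
  rcases le_total R ‖q‖ with h | h
  · exact (min_le_left _ _).trans (hR q h y)
  · have hq : q ∈ Metric.ball 0 (|R| + 1) := mem_ball_zero_iff.2 (by linarith [le_abs_self R])
    exact (min_le_right _ _).trans (abs_le.1 (hC q hq y)).1

namespace UniformlyRegular

theorem continuous (hreg : UniformlyRegular H) :
    Continuous fun q : Space n × Space n => H q.1 q.2 := by
  refine continuous_iff_continuousAt.2 fun q => ?_
  refine (hreg (‖q.1‖ + 1) (by positivity)).1.continuousOn.continuousAt
    (prod_mem_nhds (Metric.isOpen_ball.mem_nhds ?_) univ_mem)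
  simp

theorem exists_forall_le_add (hreg : UniformlyRegular H) {R ε : ℝ} (hR : 0 < R) (hε : 0 < ε) :
    ∃ δ > 0, ∀ q q' y y', ‖q‖ < R → ‖q'‖ < R → ‖q - q'‖ < δ → ‖y - y'‖ < δ →
      H q' y' ≤ H q y + ε := by
  obtain ⟨δ, hδ, hH⟩ := Metric.uniformContinuousOn_iff.1 (hreg R hR).1 ε hε
  refine ⟨δ, hδ, fun q q' y y' hq hq' hqq' hyy' => ?_⟩
  have hdist := hH (q, y) ⟨mem_ball_zero_iff.2 hq, mem_univ _⟩ (q', y')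
    ⟨mem_ball_zero_iff.2 hq', mem_univ _⟩
    (max_lt (by simpa [dist_eq_norm] using hqq') (by simpa [dist_eq_norm] using hyy'))
  linarith [(abs_lt.1 hdist).1]

theorem exists_sublevel_perturbation (hreg : UniformlyRegular H) (hcoer : CoerciveInMomentum H)
    (μ : ℝ) {ε : ℝ} (hε : 0 < ε) :
    ∃ δ > 0, ∀ q q' y, ‖q - q'‖ < δ → H q y ≤ μ → H q' y ≤ μ + ε := by
  obtain ⟨K, hK⟩ := hcoer.exists_norm_le μ
  obtain ⟨δ, hδ, hH⟩ := hreg.exists_forall_le_add (R := K + 1) (by positivity) hε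
  refine ⟨min δ 1, by positivity, fun q q' y hqq' hq => ?_⟩
  have hqK := hK q y hq
  have hq' : ‖q'‖ < K + 1 := by
    linarith [norm_le_norm_add_norm_sub q q', hqq'.trans_le (min_le_right δ 1)]
  exact (hH q q' y y (by linarith) hq' (hqq'.trans_le (min_le_left _ _)) (by simpa using hδ)).trans
    (by gcongr)

end UniformlyRegular

/-! ### Almost everywhere subsolutions -/

/-- Lipschitz functions with `F(Du, y) ≤ μ` at almost every point of `O`. For convex `F` these are
stable under convex combinations and, locally, under mollification. The Lipschitz condition is
imposed on the whole space so that mollifications are defined everywhere. -/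
def IsAESubsolution (F : Space n → Space n → ℝ) (μ : ℝ) (O : Set (Space n)) (u : Space n → ℝ) :
    Prop :=
  (∃ K, LipschitzWith K u) ∧ ∀ᵐ y ∂volume.restrict O, F (gradient u y) y ≤ μ

theorem IsViscSubsolution.isAESubsolution {F : Space n → Space n → ℝ} {μ : ℝ} {O : Set (Space n)}
    {u : Space n → ℝ} {K : NNReal} (hu : IsViscSubsolution F μ O u) (hK : LipschitzWith K u)
    (hO : IsOpen O) (hF : Continuous fun q : Space n × Space n => F q.1 q.2) :
    IsAESubsolution F μ O u := by
  refine ⟨⟨K, hK⟩, (ae_restrict_iff' hO.measurableSet).2 ?_⟩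
  filter_upwards [hK.ae_differentiableAt] with y hy hyO
  exact hu.le_of_differentiableAt hO hF hyO hy

namespace IsAESubsolution

variable {F : Space n → Space n → ℝ} {μ ν : ℝ} {O O' : Set (Space n)} {u v : Space n → ℝ}

theorem continuous (hu : IsAESubsolution F μ O u) : Continuous u :=
  hu.1.choose_spec.continuous

theorem mono (hu : IsAESubsolution F μ O u) (h : O' ⊆ O) : IsAESubsolution F μ O' u :=
  ⟨hu.1, ae_mono (Measure.restrict_mono_set _ h) hu.2⟩

theorem add_const (hu : IsAESubsolution F μ O u) (c : ℝ) :
    IsAESubsolution F μ O fun y => u y + c := by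
  obtain ⟨⟨K, hK⟩, hle⟩ := hu
  refine ⟨⟨K, by simpa using hK.add (LipschitzWith.const c)⟩, ?_⟩
  simpa only [gradient, fderiv_add_const] using hle

theorem min (hu : IsAESubsolution F μ O u) (hv : IsAESubsolution F μ O v) :
    IsAESubsolution F μ O fun y => min (u y) (v y) := by
  obtain ⟨⟨K, hK⟩, hu⟩ := hu
  obtain ⟨⟨L, hL⟩, hv⟩ := hv
  refine ⟨⟨_, hK.min hL⟩, ?_⟩
  filter_upwards [ae_restrict_of_ae hK.ae_differentiableAt,
    ae_restrict_of_ae hL.ae_differentiableAt,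
    ae_restrict_of_ae (hK.min hL).ae_differentiableAt, hu, hv] with y hdu hdv hd hu hv
  -- The minimum touches from below, at `y`, whichever of the two functions attains it there.
  rcases min_choice (u y) (v y) with h | h
  · rwa [gradient_eq_of_isLocalMax_sub hd hdu (.of_forall fun x => by
      simp only [h, sub_self, sub_nonpos, min_le_left])]
  · rwa [gradient_eq_of_isLocalMax_sub hd hdv (.of_forall fun x => by
      simp only [h, sub_self, sub_nonpos, min_le_right])]

theorem combination (hF : ConvexInMomentum F) (hu : IsAESubsolution F μ O u)
    (hv : IsAESubsolution F ν O v) {a b : ℝ} (ha : 0 ≤ a) (hb : 0 ≤ b) (hab : a + b = 1) :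
    IsAESubsolution F (a * μ + b * ν) O fun y => a * u y + b * v y := by
  obtain ⟨⟨K, hK⟩, hu⟩ := hu
  obtain ⟨⟨L, hL⟩, hv⟩ := hv
  refine ⟨⟨_, ((lipschitzWith_smul a).comp hK).add ((lipschitzWith_smul b).comp hL)⟩, ?_⟩
  filter_upwards [ae_restrict_of_ae hK.ae_differentiableAt,
    ae_restrict_of_ae hL.ae_differentiableAt, hu, hv] with y hdu hdv hu hv
  rw [(hasGradientAt_add (hasGradientAt_const_mul hdu.hasGradientAt a)
    (hasGradientAt_const_mul hdv.hasGradientAt b)).gradient]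
  calc F (a • gradient u y + b • gradient v y) y
      ≤ a * F (gradient u y) y + b * F (gradient v y) y :=
        (hF y).2 (mem_univ _) (mem_univ _) ha hb hab
    _ ≤ a * μ + b * ν := by gcongr

theorem congr_of_lipschitzWith (hu : ∀ᵐ y ∂volume.restrict O, F (gradient u y) y ≤ μ)
    (hO : IsOpen O) {K : NNReal} (hv : LipschitzWith K v) (h : EqOn u v O) :
    IsAESubsolution F μ O v := by
  refine ⟨⟨K, hv⟩, ?_⟩
  filter_upwards [hu, ae_restrict_mem hO.measurableSet] with y hy hyO
  rwa [← (h.eventuallyEq_of_mem (hO.mem_nhds hyO)).gradient_eq]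

theorem exists_contDiff_approx (hu : IsAESubsolution H μ O u) (hconv : ConvexInMomentum H)
    (hreg : UniformlyRegular H) (hO : IsOpen O) {S : Set (Space n)} (hS : IsCompact S)
    (hSO : S ⊆ O) {ε : ℝ} (hε : 0 < ε) :
    ∃ φ : Space n → ℝ, ContDiff ℝ 1 φ ∧ (∀ y, |φ y - u y| ≤ ε) ∧
      ∀ y ∈ S, H (gradient φ y) y ≤ μ + ε := by
  obtain ⟨⟨K, hK⟩, hu⟩ := hu
  obtain ⟨δ, hδ, hH⟩ := hreg.exists_forall_le_add (R := K + 1) (by positivity) hε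
  obtain ⟨η, hη, hthick⟩ := hS.exists_thickening_subset_open hO hSO
  obtain ⟨ρ, hρ, hρδ, hρη, hρK⟩ : ∃ ρ > 0, ρ ≤ δ ∧ ρ ≤ η ∧ K * ρ ≤ ε := by
    refine ⟨Min.min (Min.min δ η) (ε / (K + 1)), by positivity,
      (min_le_left _ _).trans (min_le_left _ _), (min_le_left _ _).trans (min_le_right _ _), ?_⟩
    calc (K : ℝ) * Min.min (Min.min δ η) (ε / (K + 1)) ≤ (K + 1) * (ε / (K + 1)) := by
          gcongr
          · linarith
          · exact min_le_right _ _
      _ = ε := mul_div_cancel₀ _ (by positivity)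
  let χ : ContDiffBump (0 : Space n) := ⟨ρ / 2, ρ, by positivity, by linarith⟩
  refine ⟨fun y => ∫ t, u (y - t) ∂mollifierMeasure χ volume,
    mod_cast contDiff_integral_mollifierMeasure χ volume hK.continuous (n := 1),
    fun y => (abs_integral_mollifierMeasure_sub_le χ volume hK y).trans hρK, fun y hy => ?_⟩
  have hac := mollifierMeasure_absolutelyContinuous χ (volume : Measure (Space n))
  have hsupp : ∀ᵐ t ∂mollifierMeasure χ volume, ‖t‖ < ρ := ae_mollifierMeasure_norm_lt χ volume
  -- Jensen's inequality, in the form that the sublevel sets of `H(·, y)` are closed and convex.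
  refine gradient_integral_comp_sub_mem (C := {q | H q y ≤ μ + ε}) hK hac
    (hsupp.mono fun t => le_of_lt) (by simpa using (hconv y).convex_le (μ + ε))
    (isClosed_le (hreg.continuous.comp (.prodMk_left y)) continuous_const) ?_
  filter_upwards [hsupp, ae_sub_left_of_ae hac ((ae_restrict_iff' hO.measurableSet).1 hu) y]
    with t ht hle
  have hyt : y - t ∈ O := hthick <| Metric.mem_thickening_iff.2
    ⟨y, hy, by simpa [dist_eq_norm] using ht.trans_le hρη⟩
  have hgrad : ‖gradient u (y - t)‖ < K + 1 :=
    (norm_gradient_le_of_lipschitzWith hK _).trans_lt (lt_add_one _)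
  exact (hH _ _ (y - t) y hgrad hgrad (by simpa using hδ)
    (by simpa using ht.trans_le hρδ)).trans (by gcongr; exact hle hyt)

end IsAESubsolution

theorem energy_le_coe_iff {V : Set (Space n)} {u : Space n → ℝ} {μ : ℝ} :
    energy H V u ≤ μ ↔ ∀ᵐ y ∂volume.restrict V, H (gradient u y) y ≤ μ := by
  refine ⟨fun h => ?_, fun h => essSup_le_of_ae_le _ (h.mono fun y => EReal.coe_le_coe_iff.2)⟩
  filter_upwards [ae_le_essSup (f := fun y => (H (gradient u y) y : EReal))] with y hy
  exact mod_cast hy.trans h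

/-! ### Comparison -/

theorem IsViscSupersolution.sub_le_of_contDiff_approx {F : Space n → Space n → ℝ} {μ k : ℝ}
    {W : Set (Space n)} {d z : Space n → ℝ} (hdW : IsViscSupersolution F μ W d) (hW : IsOpen W)
    (hd : Continuous d) (hz : Continuous z)
    (happrox : ∀ S, IsCompact S → S ⊆ W → ∀ ε > 0, ∃ φ : Space n → ℝ, ContDiff ℝ 1 φ ∧
      (∀ y, |φ y - z y| ≤ ε) ∧ ∀ y ∈ S, F (gradient φ y) y < μ)
    (hfrontier : ∀ y ∈ frontier W, z y - d y ≤ k)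
    (hinfty : ∀ᶠ y in cocompact (Space n) ⊓ 𝓟 W, z y - d y ≤ k) {y : Space n} (hy : y ∈ W) :
    z y - d y ≤ k := by
  by_contra! hlt
  obtain ⟨a, hka, hay⟩ := exists_between hlt
  let S : Set (Space n) := closure W ∩ {x | a ≤ z x - d x}
  have hSW : S ⊆ W := fun x hx => by
    by_contra hxW
    exact (hka.trans_le hx.2).not_ge (hfrontier x (hW.frontier_eq ▸ ⟨hx.1, hxW⟩))
  have hS : IsCompact S := by
    obtain ⟨T, hT, hTk⟩ := mem_cocompact.1 (eventually_inf_principal.1 hinfty)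
    refine hT.of_isClosed_subset
      (isClosed_closure.inter (isClosed_le continuous_const (hz.sub hd))) fun x hx => ?_
    by_contra hxT
    exact (hka.trans_le hx.2).not_ge (hTk hxT (hSW hx))
  obtain ⟨φ, hφ, hφz, hφF⟩ := happrox S hS hSW ((z y - d y - a) / 2) (by linarith)
  have hyS : y ∈ S := ⟨subset_closure hy, hay.le⟩
  obtain ⟨x, hxS, hmax⟩ := hS.exists_isMaxOn ⟨y, hyS⟩ (hφ.continuous.sub hd).continuousOn
  -- Off `S` the function `φ - d` is smaller than at `y`, so its maximum over `S` is one over `W`.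
  have hmin : IsLocalMin (fun x => d x - φ x) x := by
    filter_upwards [hW.mem_nhds (hSW hxS)] with w hw
    suffices φ w - d w ≤ φ x - d x by linarith
    by_cases hwS : w ∈ S
    · exact hmax hwS
    · have hwa : z w - d w < a := lt_of_not_ge fun h => hwS ⟨subset_closure hw, h⟩
      have hyx : φ y - d y ≤ φ x - d x := hmax hyS
      linarith [(abs_le.1 (hφz w)).2, (abs_le.1 (hφz y)).1]
  exact (hφF x hxS).not_ge (hdW.2 φ hφ x (hSW hxS) hmin)

theorem nonpos_of_forall_combination_nonpos {a b : ℝ}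
    (h : ∀ θ ∈ Ioo (0 : ℝ) 1, θ * a + (1 - θ) * b ≤ 0) : a ≤ 0 := by
  have hlim : Tendsto (fun θ : ℝ => θ * a + (1 - θ) * b) (𝓝[<] 1) (𝓝 a) := by
    have hcont : Continuous fun θ : ℝ => θ * a + (1 - θ) * b := by fun_prop
    simpa using (hcont.tendsto 1).mono_left nhdsWithin_le_nhds
  exact le_of_tendsto hlim (mem_of_superset (Ioo_mem_nhdsLT one_pos) h)

/-- Comparison at the critical level `μ` of the supersolution: `z` becomes a strict subsolution when
it is combined with `s`, which also forces the combination below `d` at infinity. -/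
theorem IsAESubsolution.sub_le (hconv : ConvexInMomentum H) (hreg : UniformlyRegular H)
    {μ μ₀ k : ℝ} {W : Set (Space n)} {d s z : Space n → ℝ} (hz : IsAESubsolution H μ W z)
    (hs : IsAESubsolution H μ₀ W s) (hμ₀ : μ₀ < μ) (hW : IsOpen W) (hd : Continuous d)
    (hdW : IsViscSupersolution H μ W d) (hfrontier : ∀ y ∈ frontier W, z y - d y ≤ k)
    (hsfrontier : BddAbove ((fun y => s y - d y) '' frontier W))
    (hinfty : (cocompact (Space n) ⊓ 𝓟 W).IsBoundedUnder (· ≤ ·) fun y => z y - d y)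
    (hsinfty : Tendsto (fun y => s y - d y) (cocompact (Space n) ⊓ 𝓟 W) atBot)
    {y : Space n} (hy : y ∈ W) : z y - d y ≤ k := by
  obtain ⟨B, hB⟩ := hsfrontier
  obtain ⟨C, hC⟩ := hinfty
  rw [← sub_nonpos]
  refine nonpos_of_forall_combination_nonpos (b := s y - d y - B) fun θ ⟨hθ₀, hθ₁⟩ => ?_
  have hθ : 0 < 1 - θ := sub_pos.2 hθ₁
  have hcomb := hz.combination hconv hs hθ₀.le hθ.le (add_sub_cancel θ 1)
  have hlevel : θ * μ + (1 - θ) * μ₀ < μ := by nlinarith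
  have hdecay : Tendsto (fun y => θ * (z y - d y) + (1 - θ) * (s y - d y))
      (cocompact (Space n) ⊓ 𝓟 W) atBot :=
    tendsto_atBot_add_left_of_ge' _ (θ * C)
      ((eventually_map.1 hC).mono fun y hy => mul_le_mul_of_nonneg_left hy hθ₀.le)
      (hsinfty.const_mul_atBot hθ)
  have hle := hdW.sub_le_of_contDiff_approx hW hd hcomb.continuous (k := θ * k + (1 - θ) * B)
    (fun S hS hSW ε hε => by
      obtain ⟨φ, hφ, hφz, hφH⟩ := hcomb.exists_contDiff_approx hconv hreg hW hS hSW
        (lt_min hε (half_pos (sub_pos.2 hlevel)))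
      refine ⟨φ, hφ, fun y => (hφz y).trans (min_le_left _ _), fun y hy => ?_⟩
      linarith [hφH y hy, min_le_right ε ((μ - (θ * μ + (1 - θ) * μ₀)) / 2)])
    (fun y hy => by
      nlinarith [mul_le_mul_of_nonneg_left (hfrontier y hy) hθ₀.le,
        mul_le_mul_of_nonneg_left (hB (mem_image_of_mem _ hy)) hθ.le])
    ((hdecay.eventually_le_atBot (θ * k + (1 - θ) * B)).mono fun y hy => by linarith) hy
  linear_combination hle

/-! ### Growth at infinity -/

section Growth

variable {E : Type*} [NormedAddCommGroup E] [ProperSpace E] {f : E → ℝ}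

theorem eventually_norm_pos_cocompact : ∀ᶠ y : E in cocompact E, 0 < ‖y‖ :=
  tendsto_norm_cocompact_atTop.eventually_gt_atTop 0

theorem isLittleO_const_norm_cocompact (c : ℝ) :
    (fun _ : E => c) =o[cocompact E] fun y => ‖y‖ :=
  Asymptotics.isLittleO_const_left.2 (.inr (by
    simpa [Function.comp_def] using tendsto_norm_cocompact_atTop))

theorem isLittleO_norm_of_tendsto_inv_mul
    (hf : Tendsto (fun y => ‖y‖⁻¹ * f y) (cocompact E) (𝓝 0)) :
    f =o[cocompact E] fun y => ‖y‖ := by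
  refine (Asymptotics.isLittleO_iff_tendsto' ?_).2 (by simpa only [inv_mul_eq_div] using hf)
  exact eventually_norm_pos_cocompact.mono fun y hy h => absurd h hy.ne'

theorem tendsto_sub_const_mul_norm_atBot (hf : f =o[cocompact E] fun y => ‖y‖) {c : ℝ}
    (hc : 0 < c) : Tendsto (fun y => f y - c * ‖y‖) (cocompact E) atBot := by
  refine tendsto_atBot_mono' _ ?_
    (tendsto_norm_cocompact_atTop.const_mul_atTop_of_neg (neg_lt_zero.2 (half_pos hc)))
  filter_upwards [hf.def (half_pos hc)] with y hy
  rw [norm_norm] at hy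
  linarith [(abs_le.1 hy).2]

theorem zero_lt_liminf_inv_norm_mul_iff :
    (0 : EReal) < liminf (fun y => ((‖y‖⁻¹ * f y : ℝ) : EReal)) (cocompact E) ↔
      ∃ c > 0, ∀ᶠ y in cocompact E, c * ‖y‖ ≤ f y := by
  constructor
  · intro h
    obtain ⟨c, hc, hlt⟩ := EReal.lt_iff_exists_real_btwn.1 h
    refine ⟨c, mod_cast hc, ?_⟩
    filter_upwards [eventually_lt_of_lt_liminf hlt, eventually_norm_pos_cocompact] with y hy hpos
    rw [EReal.coe_lt_coe_iff, inv_mul_eq_div, lt_div_iff₀ hpos] at hy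
    exact hy.le
  · rintro ⟨c, hc, hle⟩
    refine lt_of_lt_of_le (b := (c : EReal)) (mod_cast hc)
      (le_liminf_of_le (by isBoundedDefault) ?_)
    filter_upwards [hle, eventually_norm_pos_cocompact] with y hy hpos
    rwa [EReal.coe_le_coe_iff, inv_mul_eq_div, le_div_iff₀ hpos]

end Growth

/-! ### The effective Hamiltonian -/

section EffectiveHamiltonian

variable {p : Space n} {μ : ℝ}

theorem subsolutionLevels_nonempty (hreg : UniformlyRegular H) (p : Space n) :
    (subsolutionLevels H p).Nonempty := by
  obtain ⟨C, hC⟩ := (hreg (‖p‖ + 1) (by positivity)).2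
  refine ⟨C, fun _ => 0, ⟨0, LipschitzWith.const _⟩,
    ⟨continuousOn_const.upperSemicontinuousOn, fun φ hφ x _ hmax => ?_⟩,
    by simpa using tendsto_const_nhds⟩
  have h := gradient_eq_of_isLocalMax_sub (differentiableAt_const (0 : ℝ))
    (hφ.differentiable one_ne_zero x) hmax
  simp only [← h, gradient_fun_const, add_zero]
  exact (abs_le.1 (hC p (by simp) x)).2

theorem le_of_mem_subsolutionLevels (hμ : μ ∈ subsolutionLevels H p) {M : ℝ}
    (hM : ∀ q y, ‖q‖ ≤ 1 → M ≤ H (p + q) y) : M ≤ μ := by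
  obtain ⟨w, -, hw, hlim⟩ := hμ
  have hsub := (isLittleO_norm_of_tendsto_inv_mul hlim).sub (isLittleO_const_norm_cocompact (w 0))
  have hneg := (tendsto_sub_const_mul_norm_atBot hsub (half_pos one_pos)).eventually_lt_atBot 0
  rw [← Metric.cobounded_eq_cocompact] at hneg
  obtain ⟨R, -, hR⟩ := Filter.hasBasis_cobounded_norm.eventually_iff.1 hneg
  have hr : 0 < max R 1 := lt_max_of_lt_right one_pos
  -- Touch `w` from above by a paraboloid whose gradients on the ball of radius `max R 1` have norm
  -- at most `1`.
  obtain ⟨y, hy, hle⟩ := hw.exists_mem_ball_add_smul_le (x := 0) (A := 1 / (2 * max R 1))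
    (contDiff_const (c := (0 : ℝ))) hr.le (subset_univ _) fun y hy => by
      have hyr : ‖y‖ = max R 1 := mem_sphere_zero_iff_norm.1 hy
      have hlt := hR (show R ≤ ‖y‖ from hyr ▸ le_max_left _ _)
      rw [show 1 / (2 * max R 1) * max R 1 ^ 2 = 1 / 2 * max R 1 by field_simp, ← hyr]
      linarith
  refine (hM _ y ?_).trans hle
  rw [gradient_fun_const, zero_add, sub_zero, norm_smul, Real.norm_of_nonneg (by positivity)]
  calc 2 * (1 / (2 * max R 1)) * ‖y‖ ≤ 2 * (1 / (2 * max R 1)) * max R 1 := by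
        gcongr; exact (mem_ball_zero_iff.1 hy).le
    _ = 1 := by field_simp

theorem subsolutionLevels_bddBelow (hcoer : CoerciveInMomentum H) (hreg : UniformlyRegular H)
    (p : Space n) : BddBelow (subsolutionLevels H p) := by
  obtain ⟨M, hM⟩ := hcoer.exists_forall_le hreg
  exact ⟨M, fun μ hμ => le_of_mem_subsolutionLevels hμ fun q y _ => hM _ y⟩

theorem exists_isViscSubsolution_perturbation (hcoer : CoerciveInMomentum H)
    (hreg : UniformlyRegular H) {ν : ℝ} (hμν : μ < ν) :
    ∃ δ > 0, ∀ p p' : Space n, dist p p' < δ → ∀ O w,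
      IsViscSubsolution (fun q y => H (p + q) y) μ O w →
        IsViscSubsolution (fun q y => H (p' + q) y) ν O w := by
  obtain ⟨δ, hδ, hpert⟩ := hreg.exists_sublevel_perturbation hcoer μ (sub_pos.2 hμν)
  refine ⟨δ, hδ, fun p p' hp O w hw => hw.imp fun q y _ hle => ?_⟩
  rw [← add_sub_cancel μ ν]
  exact hpert _ _ y (by rwa [add_sub_add_right_eq_sub, ← dist_eq_norm]) hle

theorem exists_isViscSubsolution_of_effectiveH_lt (hcoer : CoerciveInMomentum H)
    (hreg : UniformlyRegular H) (hμ : effectiveH H p < μ) :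
    ∃ δ > 0, ∃ w : Space n → ℝ, Continuous w ∧ w =o[cocompact (Space n)] (fun y => ‖y‖) ∧
      ∀ p', dist p p' < δ → IsViscSubsolution (fun q y => H (p' + q) y) μ univ w := by
  obtain ⟨μ₀, ⟨w, ⟨K, hK⟩, hw, hlim⟩, hμ₀⟩ :=
    exists_lt_of_csInf_lt (subsolutionLevels_nonempty hreg p) hμ
  obtain ⟨δ, hδ, hpert⟩ := exists_isViscSubsolution_perturbation hcoer hreg hμ₀
  exact ⟨δ, hδ, w, hK.continuous, isLittleO_norm_of_tendsto_inv_mul hlim,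
    fun p' hp' => hpert p p' hp' _ _ hw⟩

theorem lowerSemicontinuous_effectiveH (hcoer : CoerciveInMomentum H) (hreg : UniformlyRegular H) :
    LowerSemicontinuous (effectiveH H) := by
  intro p a ha
  obtain ⟨b, hab, hbp⟩ := exists_between ha
  obtain ⟨c, hac, hcb⟩ := exists_between hab
  obtain ⟨δ, hδ, hpert⟩ := exists_isViscSubsolution_perturbation hcoer hreg hcb
  filter_upwards [Metric.ball_mem_nhds p hδ] with p' hp'
  by_contra! hle
  obtain ⟨μ, ⟨w, hK, hw, hlim⟩, hμc⟩ :=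
    exists_lt_of_csInf_lt (subsolutionLevels_nonempty hreg p') (hle.trans_lt hac)
  have hb : b ∈ subsolutionLevels H p :=
    ⟨w, hK, hpert p' p hp' _ _ (hw.imp fun _ _ _ h => h.trans hμc.le), hlim⟩
  exact hbp.not_ge (csInf_le (subsolutionLevels_bddBelow hcoer hreg p) hb)

theorem exists_forall_effectiveH_le (hcoer : CoerciveInMomentum H) (hreg : UniformlyRegular H) :
    ∃ p, ∀ p', effectiveH H p ≤ effectiveH H p' := by
  obtain ⟨R, hR⟩ := hcoer (effectiveH H 0)
  obtain ⟨p, -, hp⟩ := ((lowerSemicontinuous_effectiveH hcoer hreg).lowerSemicontinuousOn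
    (Metric.closedBall 0 (|R| + 1))).exists_isMinOn
    ⟨0, Metric.mem_closedBall_self (by positivity)⟩ (isCompact_closedBall _ _)
  refine ⟨p, fun p' => ?_⟩
  rcases le_total ‖p'‖ (|R| + 1) with h | h
  · exact hp (mem_closedBall_zero_iff.2 h)
  · have hp0 : effectiveH H p ≤ effectiveH H 0 := hp (Metric.mem_closedBall_self (by positivity))
    refine hp0.trans (le_csInf (subsolutionLevels_nonempty hreg p') fun μ hμ => ?_)
    refine le_of_mem_subsolutionLevels hμ fun q y hq => hR _ ?_ y
    linarith [le_abs_self R, norm_le_add_norm_add p' q]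

end EffectiveHamiltonian

/-! ### Perron's method -/

section Perron

variable {F : Space n → Space n → ℝ} {μ : ℝ} {O : Set (Space n)} {m w ψ φ : Space n → ℝ}
  {x : Space n} {r : ℝ}

theorem IsViscSubsolution.of_le_of_touching (hm : IsViscSubsolution F μ O m)
    (hw : UpperSemicontinuousOn w O) (hmw : ∀ y, m y ≤ w y)
    (htouch : ∀ y ∈ O, m y < w y → ∃ ψ : Space n → ℝ, DifferentiableAt ℝ ψ y ∧ ψ ≤ᶠ[𝓝 y] w ∧
      ψ y = w y ∧ F (gradient ψ y) y ≤ μ) : IsViscSubsolution F μ O w := by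
  refine ⟨hw, fun φ hφ y hy hmax => ?_⟩
  rcases (hmw y).eq_or_lt with heq | hlt
  · refine hm.2 φ hφ y hy ?_
    filter_upwards [hmax] with z hz
    linarith [hmw z]
  · obtain ⟨ψ, hψ, hψw, hψy, hle⟩ := htouch y hy hlt
    have hmax' : IsLocalMax (fun z => ψ z - φ z) y := by
      filter_upwards [hmax, hψw] with z hz hψz
      linarith
    rwa [← gradient_eq_of_isLocalMax_sub hψ (hφ.differentiable one_ne_zero y) hmax']

theorem IsViscSubsolution.exists_glue_max (hm : IsViscSubsolution F μ O m) (hmc : Continuous m)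
    (hψ : ContDiff ℝ 1 ψ) (hψF : ∀ y ∈ Metric.ball x r, F (gradient ψ y) y ≤ μ)
    (hsphere : ∀ y ∈ Metric.sphere x r, ψ y < m y) :
    ∃ w : Space n → ℝ, Continuous w ∧ IsViscSubsolution F μ O w ∧
      (∀ y ∈ Metric.closedBall x r, ψ y ≤ w y) ∧ ∀ y ∉ Metric.closedBall x r, w y = m y := by
  let w : Space n → ℝ := fun y => if dist y x ≤ r then max (m y) (ψ y) else m y
  have hin : ∀ y ∈ Metric.closedBall x r, w y = max (m y) (ψ y) := fun y hy => if_pos hy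
  have hout : ∀ y ∉ Metric.closedBall x r, w y = m y := fun y hy => if_neg hy
  have hψw : ∀ y ∈ Metric.closedBall x r, ψ y ≤ w y := fun y hy => hin y hy ▸ le_max_right _ _
  have hwc : Continuous w := (hmc.max hψ.continuous).if_le hmc (by fun_prop) continuous_const
    fun y hy => max_eq_left (hsphere y hy).le
  have hmw : ∀ y, m y ≤ w y := fun y => by
    by_cases hy : y ∈ Metric.closedBall x r
    · exact hin y hy ▸ le_max_left _ _
    · exact (hout y hy).ge
  refine ⟨w, hwc, hm.of_le_of_touching hwc.continuousOn.upperSemicontinuousOn hmw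
    fun y _ hlt => ⟨ψ, hψ.differentiable one_ne_zero y, ?_⟩, hψw, hout⟩
  have hyr : y ∈ Metric.closedBall x r := by
    by_contra hyr
    exact hlt.ne' (hout y hyr)
  have hlt' : m y < ψ y := by simpa [hin y hyr] using hlt
  have hball : y ∈ Metric.ball x r :=
    lt_of_le_of_ne hyr fun h => (hsphere y h).not_gt hlt'
  refine ⟨?_, (hin y hyr ▸ max_eq_right hlt'.le).symm, hψF y hball⟩
  filter_upwards [Metric.closedBall_mem_nhds_of_mem hball] with z hz using hψw z hz

theorem IsViscSubsolution.exists_gt_of_isLocalMin (hm : IsViscSubsolution F μ O m)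
    (hmc : Continuous m) (hF : Continuous fun q : Space n × Space n => F q.1 q.2)
    (hφ : ContDiff ℝ 1 φ) (hmin : IsLocalMin (fun y => m y - φ y) x)
    (hlt : F (gradient φ x) x < μ) {U : Set (Space n)} (hU : U ∈ 𝓝 x) :
    ∃ w : Space n → ℝ, Continuous w ∧ IsViscSubsolution F μ O w ∧ m x < w x ∧
      ∀ y ∉ U, w y = m y := by
  have hgrad : ∀ y c, HasGradientAt (fun y => φ y + (-1) * ‖y - x‖ ^ 2 + c)
      (gradient φ y + (-1 : ℝ) • (2 : ℝ) • (y - x)) y := fun y c =>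
    hasGradientAt_add_const (hasGradientAt_add (hφ.differentiable one_ne_zero y).hasGradientAt
      (hasGradientAt_const_mul (hasGradientAt_norm_sub_sq x y) (-1))) c
  have hstrict : ∀ᶠ y in 𝓝 x, F (gradient φ y + (-1 : ℝ) • (2 : ℝ) • (y - x)) y < μ := by
    have hcont : Continuous fun y => F (gradient φ y + (-1 : ℝ) • (2 : ℝ) • (y - x)) y :=
      hF.comp (((continuous_gradient_of_contDiff hφ).add (by fun_prop)).prodMk continuous_id)
    exact hcont.continuousAt.eventually (gt_mem_nhds (by simpa using hlt))
  obtain ⟨r, hr, hball⟩ := Metric.nhds_basis_closedBall.eventually_iff.1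
    ((hstrict.and hmin).and hU)
  -- On the sphere `φ - ‖· - x‖²` lies `r²` below its value at `x` relative to `m`, which leaves
  -- room to lift it by half of that.
  obtain ⟨w, hwc, hw, hψw, hout⟩ := hm.exists_glue_max hmc (x := x) (r := r)
    (ψ := fun y => φ y + (-1) * ‖y - x‖ ^ 2 + (m x - φ x + r ^ 2 / 2))
    ((hφ.add (contDiff_const.mul ((contDiff_id.sub contDiff_const).norm_sq ℝ))).add
      contDiff_const)
    (fun y hy => by
      rw [(hgrad y _).gradient]
      exact (hball (Metric.ball_subset_closedBall hy)).1.1.le)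
    fun y hy => by
      have hmin' := (hball (Metric.sphere_subset_closedBall hy)).1.2
      have : 0 < r ^ 2 := by positivity
      rw [mem_sphere_iff_norm.1 hy]
      linarith
  refine ⟨w, hwc, hw, ?_, fun y hy => hout y fun hyr => hy (hball hyr).2⟩
  have hx := hψw x (Metric.mem_closedBall_self hr.le)
  have : 0 < r ^ 2 := by positivity
  simp only [sub_self, norm_zero] at hx
  linarith

end Perron

/-- The competitors in the construction of the distance function with vertex `x₀` by Perron's
method: continuous subsolutions at level `μ` in the whole space that vanish at `x₀`. -/
def pointedSubsolutions (H : Space n → Space n → ℝ) (μ : ℝ) (x₀ : Space n) :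
    Set (Space n → ℝ) :=
  {w | Continuous w ∧ IsViscSubsolution H μ univ w ∧ w x₀ = 0}

/-- The largest subsolution at level `μ` vanishing at `x₀`, which turns out to be the distance
function. The supremum has its junk value if there is no subsolution at all. -/
def maximalSubsolution (H : Space n → Space n → ℝ) (μ : ℝ) (x₀ y : Space n) : ℝ :=
  sSup ((fun w => w y) '' pointedSubsolutions H μ x₀)

section Maximal

variable {μ : ℝ} {x₀ : Space n} {K : NNReal} {w : Space n → ℝ}

theorem lipschitzWith_of_mem_pointedSubsolutions (hw : w ∈ pointedSubsolutions H μ x₀)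
    (hK : ∀ p y, H p y ≤ μ → ‖p‖ ≤ K) : LipschitzWith K w :=
  hw.2.1.lipschitzWith hw.1 hK fun _ => univ_mem

theorem isLUB_maximalSubsolution (hne : (pointedSubsolutions H μ x₀).Nonempty)
    (hK : ∀ p y, H p y ≤ μ → ‖p‖ ≤ K) (y : Space n) :
    IsLUB ((fun w => w y) '' pointedSubsolutions H μ x₀) (maximalSubsolution H μ x₀ y) := by
  refine isLUB_csSup (hne.image _) ⟨K * dist y x₀, ?_⟩
  rintro _ ⟨w, hw, rfl⟩
  simpa [hw.2.2] using (lipschitzWith_of_mem_pointedSubsolutions hw hK).le_add_mul y x₀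

theorem maximalSubsolution_vertex (hne : (pointedSubsolutions H μ x₀).Nonempty) :
    maximalSubsolution H μ x₀ x₀ = 0 := by
  have himage : (fun w : Space n → ℝ => w x₀) '' pointedSubsolutions H μ x₀ = {0} :=
    (image_congr fun w hw => hw.2.2).trans (hne.image_const 0)
  rw [maximalSubsolution, himage, csSup_singleton]

theorem lipschitzWith_maximalSubsolution (hne : (pointedSubsolutions H μ x₀).Nonempty)
    (hK : ∀ p y, H p y ≤ μ → ‖p‖ ≤ K) : LipschitzWith K (maximalSubsolution H μ x₀) := by
  refine LipschitzWith.of_le_add_mul K fun y x => (isLUB_maximalSubsolution hne hK y).2 ?_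
  rintro _ ⟨w, hw, rfl⟩
  calc w y ≤ w x + K * dist y x :=
        (lipschitzWith_of_mem_pointedSubsolutions hw hK).le_add_mul y x
    _ ≤ maximalSubsolution H μ x₀ x + K * dist y x := by
        gcongr
        exact (isLUB_maximalSubsolution hne hK x).1 (mem_image_of_mem _ hw)

theorem isViscSubsolution_maximalSubsolution (hne : (pointedSubsolutions H μ x₀).Nonempty)
    (hK : ∀ p y, H p y ≤ μ → ‖p‖ ≤ K)
    (hH : Continuous fun q : Space n × Space n => H q.1 q.2) :
    IsViscSubsolution H μ univ (maximalSubsolution H μ x₀) :=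
  .of_isLUB (fun _ hw => hw.2.1) isOpen_univ hH
    (lipschitzWith_maximalSubsolution hne hK).continuous.continuousOn.upperSemicontinuousOn
    (isLUB_maximalSubsolution hne hK)

theorem isViscSupersolution_maximalSubsolution (hne : (pointedSubsolutions H μ x₀).Nonempty)
    (hK : ∀ p y, H p y ≤ μ → ‖p‖ ≤ K)
    (hH : Continuous fun q : Space n × Space n => H q.1 q.2) :
    IsViscSupersolution H μ {x₀}ᶜ (maximalSubsolution H μ x₀) := by
  have hcont := (lipschitzWith_maximalSubsolution hne hK).continuous
  refine ⟨hcont.continuousOn.lowerSemicontinuousOn, fun φ hφ x hx hmin => ?_⟩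
  by_contra! hlt
  obtain ⟨w, hwc, hw, hwx, hwx₀⟩ :=
    (isViscSubsolution_maximalSubsolution hne hK hH).exists_gt_of_isLocalMin hcont hH hφ hmin hlt
      (isOpen_compl_singleton.mem_nhds hx)
  have hmem : w ∈ pointedSubsolutions H μ x₀ :=
    ⟨hwc, hw, (hwx₀ x₀ (by simp)).trans (maximalSubsolution_vertex hne)⟩
  exact hwx.not_ge ((isLUB_maximalSubsolution hne hK x).1 (mem_image_of_mem _ hmem))

end Maximal

/-! ### Distance functions -/

section Tilt

variable {F : Space n → Space n → ℝ} {μ : ℝ} {O : Set (Space n)} {w : Space n → ℝ}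

theorem IsViscSubsolution.add_inner {p : Space n}
    (hw : IsViscSubsolution (fun q y => F (p + q) y) μ O w) (x₀ : Space n) :
    IsViscSubsolution F μ O fun y => w y + inner ℝ p (y - x₀) := by
  simpa only [(hasGradientAt_inner_sub p x₀ _).gradient, add_sub_cancel] using
    hw.add_contDiff (contDiff_inner_sub p x₀)

theorem IsViscSupersolution.add_inner {p : Space n}
    (hw : IsViscSupersolution (fun q y => F (p + q) y) μ O w) (x₀ : Space n) :
    IsViscSupersolution F μ O fun y => w y + inner ℝ p (y - x₀) := by
  simpa only [(hasGradientAt_inner_sub p x₀ _).gradient, add_sub_cancel] using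
    hw.add_contDiff (contDiff_inner_sub p x₀)

theorem IsViscSolution.sub_inner (hw : IsViscSolution F μ O w) (p x₀ : Space n) :
    IsViscSolution (fun q y => F (p + q) y) μ O fun y => w y - inner ℝ p (y - x₀) := by
  have hw' : IsViscSolution (fun q y => F (p + (-p + q)) y) μ O w := by
    simpa only [add_neg_cancel_left] using hw
  have hsub := hw'.1.add_inner (F := fun q y => F (p + q) y) x₀
  have hsuper := hw'.2.add_inner (F := fun q y => F (p + q) y) x₀
  simp only [inner_neg_left, ← sub_eq_add_neg] at hsub hsuper
  exact ⟨hsub, hsuper⟩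

theorem IsViscSubsolution.add_inner_sub_mem_pointedSubsolutions {p : Space n}
    (hw : IsViscSubsolution (fun q y => F (p + q) y) μ univ w) (hwc : Continuous w)
    (x₀ : Space n) :
    (fun y => w y + inner ℝ p (y - x₀) - w x₀) ∈ pointedSubsolutions F μ x₀ := by
  refine ⟨by fun_prop, ?_, by simp⟩
  simpa only [gradient_fun_const, sub_zero, ← sub_eq_add_neg] using
    (hw.add_inner x₀).add_contDiff (contDiff_const (c := -w x₀))

end Tilt

section Distance

variable {μ : ℝ} {x₀ p : Space n} {d : Space n → ℝ}

theorem exists_const_mul_norm_le_maximalSubsolution (hcoer : CoerciveInMomentum H)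
    (hreg : UniformlyRegular H) (hμ : effectiveH H p < μ) (x₀ : Space n) :
    (pointedSubsolutions H μ x₀).Nonempty ∧ ∃ c > 0, ∀ᶠ y in cocompact (Space n),
      c * ‖y‖ ≤ maximalSubsolution H μ x₀ y - inner ℝ p (y - x₀) := by
  obtain ⟨K, hK⟩ := hcoer.exists_norm_le μ
  obtain ⟨δ, hδ, w, hwc, hwo, hw⟩ := exists_isViscSubsolution_of_effectiveH_lt hcoer hreg hμ
  have hmem : ∀ p', dist p p' < δ → _ := fun p' hp' =>
    (hw p' hp').add_inner_sub_mem_pointedSubsolutions hwc x₀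
  have hne : (pointedSubsolutions H μ x₀).Nonempty := ⟨_, hmem p (by simpa using hδ)⟩
  refine ⟨hne, δ / 4, by positivity, ?_⟩
  -- Tilting `w` by slopes other than `p`, in the direction of `y - x₀`, gains linear growth.
  have htilt : ∀ y ≠ x₀, w y + δ / 2 * ‖y - x₀‖ - w x₀ ≤
      maximalSubsolution H μ x₀ y - inner ℝ p (y - x₀) := by
    intro y hy
    have hpos : 0 < ‖y - x₀‖ := norm_pos_iff.2 (sub_ne_zero.2 hy)
    have hle := (isLUB_maximalSubsolution hne hK y).1 <| mem_image_of_mem _ <|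
      hmem (p + (δ / 2 / ‖y - x₀‖) • (y - x₀)) <| by
        rw [dist_self_add_right, norm_smul, Real.norm_of_nonneg (by positivity),
          div_mul_cancel₀ _ hpos.ne']
        exact half_lt_self hδ
    have hinner : inner ℝ ((δ / 2 / ‖y - x₀‖) • (y - x₀)) (y - x₀) = δ / 2 * ‖y - x₀‖ := by
      rw [real_inner_smul_left, real_inner_self_eq_norm_sq]
      field_simp
    simp only [inner_add_left, hinner] at hle
    linarith
  have hconst := isLittleO_const_norm_cocompact (E := Space n) (w x₀ + δ / 2 * ‖x₀‖)
  filter_upwards [(hwo.sub hconst).def (show 0 < δ / 4 by positivity),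
    (isCompact_singleton (x := x₀)).compl_mem_cocompact] with y hy hyx₀
  rw [norm_norm] at hy
  have hnorm : δ / 2 * (‖y‖ - ‖x₀‖) ≤ δ / 2 * ‖y - x₀‖ := by
    gcongr; exact norm_sub_norm_le y x₀
  linarith [htilt y hyx₀, (abs_le.1 hy).1]

theorem isDistanceFunction_maximalSubsolution (hcoer : CoerciveInMomentum H)
    (hreg : UniformlyRegular H) (hp : ∀ p', effectiveH H p ≤ effectiveH H p')
    (hμ : effectiveH H p < μ) (x₀ : Space n) :
    IsDistanceFunction H μ x₀ (maximalSubsolution H μ x₀) := by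
  obtain ⟨K, hK⟩ := hcoer.exists_norm_le μ
  obtain ⟨hne, hgrowth⟩ := exists_const_mul_norm_le_maximalSubsolution hcoer hreg hμ x₀
  have hsol : IsViscSolution H μ {x₀}ᶜ (maximalSubsolution H μ x₀) :=
    ⟨(isViscSubsolution_maximalSubsolution hne hK hreg.continuous).mono (subset_univ _),
      isViscSupersolution_maximalSubsolution hne hK hreg.continuous⟩
  refine ⟨p, hp, fun y => maximalSubsolution H μ x₀ y - inner ℝ p (y - x₀),
    ⟨?_, ?_, hsol.sub_inner p x₀, zero_lt_liminf_inv_norm_mul_iff.2 hgrowth⟩,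
    fun y => (sub_add_cancel _ _).symm⟩
  · exact (lipschitzWith_maximalSubsolution hne hK).continuous.sub
      (contDiff_inner_sub p x₀).continuous
  · simp [maximalSubsolution_vertex hne]

theorem exists_isAESubsolution_lt (hcoer : CoerciveInMomentum H) (hreg : UniformlyRegular H)
    (hμ : effectiveH H p < μ) (x₀ : Space n) :
    ∃ μ₀ < μ, ∃ s : Space n → ℝ, IsAESubsolution H μ₀ univ s ∧
      (fun y => s y - inner ℝ p (y - x₀)) =o[cocompact (Space n)] fun y => ‖y‖ := by
  obtain ⟨μ₀, hpμ₀, hμ₀⟩ := exists_between hμ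
  obtain ⟨K, hK⟩ := hcoer.exists_norm_le μ₀
  obtain ⟨δ, hδ, w, hwc, hwo, hw⟩ := exists_isViscSubsolution_of_effectiveH_lt hcoer hreg hpμ₀
  have hs := (hw p (by simpa using hδ)).add_inner_sub_mem_pointedSubsolutions hwc x₀
  refine ⟨μ₀, hμ₀, _, hs.2.1.isAESubsolution (lipschitzWith_of_mem_pointedSubsolutions hs hK)
    isOpen_univ hreg.continuous, ?_⟩
  refine (hwo.sub (isLittleO_const_norm_cocompact (w x₀))).congr_left fun y => ?_
  ring

namespace IsDistanceFunction

theorem continuous (hd : IsDistanceFunction H μ x₀ d) : Continuous d := by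
  obtain ⟨p, -, d', hd', hdd'⟩ := hd
  rw [funext hdd']
  exact hd'.1.add (contDiff_inner_sub p x₀).continuous

theorem apply_vertex (hd : IsDistanceFunction H μ x₀ d) : d x₀ = 0 := by
  obtain ⟨p, -, d', hd', hdd'⟩ := hd
  rw [hdd', hd'.2.1, sub_self, inner_zero_right, add_zero]

theorem isViscSolution (hd : IsDistanceFunction H μ x₀ d) : IsViscSolution H μ {x₀}ᶜ d := by
  obtain ⟨p, -, d', hd', hdd'⟩ := hd
  rw [funext hdd']
  exact ⟨hd'.2.2.1.1.add_inner x₀, hd'.2.2.1.2.add_inner x₀⟩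

theorem exists_growth (hd : IsDistanceFunction H μ x₀ d) :
    ∃ p, (∀ p', effectiveH H p ≤ effectiveH H p') ∧ ∃ c > 0,
      ∀ᶠ y in cocompact (Space n), c * ‖y‖ ≤ d y - inner ℝ p (y - x₀) := by
  obtain ⟨p, hp, d', hd', hdd'⟩ := hd
  refine ⟨p, hp, ?_⟩
  simpa only [hdd', add_sub_cancel_right] using zero_lt_liminf_inv_norm_mul_iff.1 hd'.2.2.2

theorem exists_lipschitzWith (hd : IsDistanceFunction H μ x₀ d) (hcoer : CoerciveInMomentum H) :
    ∃ K, LipschitzWith K d := by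
  obtain ⟨K, hK⟩ := hcoer.exists_norm_le μ
  exact ⟨K, hd.isViscSolution.1.lipschitzWith hd.continuous hK (compl_singleton_mem_nhdsNE x₀)⟩

theorem isAESubsolution (hd : IsDistanceFunction H μ x₀ d) (hcoer : CoerciveInMomentum H)
    (hreg : UniformlyRegular H) : IsAESubsolution H μ {x₀}ᶜ d := by
  obtain ⟨K, hK⟩ := hd.exists_lipschitzWith hcoer
  exact hd.isViscSolution.1.isAESubsolution hK isOpen_compl_singleton hreg.continuous

theorem le (hconv : ConvexInMomentum H) (hcoer : CoerciveInMomentum H)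
    (hreg : UniformlyRegular H) (hμ : ∃ p, effectiveH H p < μ) {d₁ d₂ : Space n → ℝ}
    (h₁ : IsDistanceFunction H μ x₀ d₁) (h₂ : IsDistanceFunction H μ x₀ d₂) : d₂ ≤ d₁ := by
  obtain ⟨p, hp, c, hc, hgrowth⟩ := h₁.exists_growth
  obtain ⟨p', hp'⟩ := hμ
  obtain ⟨μ₀, hμ₀, s, hs, hso⟩ :=
    exists_isAESubsolution_lt hcoer hreg ((hp p').trans_lt hp') x₀
  have hfrontier : frontier ({x₀}ᶜ : Set (Space n)) ⊆ {x₀} :=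
    (frontier_compl _).trans_subset isClosed_singleton.frontier_subset
  have hdecay : Tendsto (fun y => s y - d₁ y) (cocompact (Space n)) atBot := by
    refine tendsto_atBot_mono' _ ?_ (tendsto_sub_const_mul_norm_atBot hso hc)
    filter_upwards [hgrowth] with y hy
    linarith
  -- Truncation makes `d₂` comparable to `d₁` at infinity.
  have htrunc := (h₂.isAESubsolution hcoer hreg).min
    ((h₁.isAESubsolution hcoer hreg).add_const 1)
  intro y
  rcases eq_or_ne y x₀ with rfl | hy
  · rw [h₁.apply_vertex, h₂.apply_vertex]
  have hle : min (d₂ y) (d₁ y + 1) - d₁ y ≤ 0 :=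
    htrunc.sub_le hconv hreg (hs.mono (subset_univ _)) hμ₀ isOpen_compl_singleton h₁.continuous
      h₁.isViscSolution.2
      (fun z hz => by simp [mem_singleton_iff.1 (hfrontier hz), h₁.apply_vertex, h₂.apply_vertex])
      (((finite_singleton x₀).subset hfrontier).image _).bddAbove
      (isBoundedUnder_of ⟨1, fun z => by linarith [min_le_right (d₂ z) (d₁ z + 1)]⟩)
      (hdecay.mono_left inf_le_left) hy
  exact (min_le_iff.1 (sub_nonpos.1 hle)).resolve_right (lt_add_one _).not_ge

end IsDistanceFunction

theorem existsUnique_isDistanceFunction (hconv : ConvexInMomentum H) (hcoer : CoerciveInMomentum H)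
    (hreg : UniformlyRegular H) (hμ : ∃ p, effectiveH H p < μ) (x₀ : Space n) :
    ∃! d, IsDistanceFunction H μ x₀ d := by
  obtain ⟨p, hp⟩ := exists_forall_effectiveH_le hcoer hreg
  have hpμ : effectiveH H p < μ := let ⟨p', hp'⟩ := hμ; (hp p').trans_lt hp'
  have hm := isDistanceFunction_maximalSubsolution hcoer hreg hp hpμ x₀
  exact ⟨_, hm, fun d hd => le_antisymm (hm.le hconv hcoer hreg hμ hd)
    (hd.le hconv hcoer hreg hμ hm)⟩

end Distance

/-! ### Comparison with distance functions -/

section Comparison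

theorem closure_inter_superlevel_subset {X : Type*} [TopologicalSpace X] {V : Set X} {f : X → ℝ}
    (hf : ContinuousOn f (closure V)) (k : ℝ) :
    closure (V ∩ {y | k < f y}) ⊆ closure V ∩ {y | k ≤ f y} :=
  closure_minimal (fun _ hy => ⟨subset_closure hy.1, hy.2.out.le⟩)
    (hf.preimage_isClosed_of_isClosed isClosed_closure isClosed_Ici)

theorem eq_of_mem_frontier_inter_superlevel {X : Type*} [TopologicalSpace X] {V : Set X}
    (hV : IsOpen V) {f : X → ℝ} (hf : ContinuousOn f (closure V)) {k : ℝ}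
    (hk : ∀ y ∈ frontier V, f y ≤ k) {y : X} (hy : y ∈ frontier (V ∩ {y | k < f y})) :
    f y = k := by
  have hWo : IsOpen (V ∩ {y | k < f y}) :=
    (hf.mono subset_closure).isOpen_inter_preimage hV isOpen_Ioi
  rw [hWo.frontier_eq] at hy
  obtain ⟨hyV, hky⟩ := closure_inter_superlevel_subset hf k hy.1
  refine le_antisymm (le_of_not_gt fun hlt => ?_) hky
  by_cases hyV' : y ∈ V
  · exact hy.2 ⟨hyV', hlt⟩
  · exact (hk y (hV.frontier_eq ▸ ⟨hyV, hyV'⟩)).not_gt hlt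

theorem CompactlyInside.mono {U V W : Set (Space n)} (hV : CompactlyInside V U) (hW : IsOpen W)
    (hWV : W ⊆ V) : CompactlyInside W U :=
  ⟨hW, hV.2.1.of_isClosed_subset isClosed_closure (closure_mono hWV),
    (closure_mono hWV).trans hV.2.2⟩

namespace IsAbsSubminimizer

variable {U V W O : Set (Space n)} {u v d : Space n → ℝ} {μ k : ℝ}

theorem exists_isAESubsolution (hu : IsAbsSubminimizer H U u) (hW : CompactlyInside W U)
    (hv : IsAESubsolution H μ W v) (hle : ∀ y ∈ W, v y ≤ u y)
    (heq : ∀ y ∈ frontier W, v y = u y) :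
    ∃ g, IsAESubsolution H μ W g ∧ EqOn u g (closure W) := by
  obtain ⟨⟨K, hK⟩, hvμ⟩ := hv
  have henergy : energy H W u ≤ μ :=
    (hu.2 W hW v ⟨K, hK.lipschitzOnWith⟩ hle heq).trans (energy_le_coe_iff.2 hvμ)
  obtain ⟨L, hL⟩ := (hu.1.mono hW.2.2).exists_lipschitzOnWith_of_compact hW.2.1
  obtain ⟨g, hg, hug⟩ := hL.extend_real
  exact ⟨g, .congr_of_lipschitzWith (energy_le_coe_iff.1 henergy) hW.1 hg
    (hug.mono subset_closure), hug⟩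

theorem sub_le (hu : IsAbsSubminimizer H U u) (hconv : ConvexInMomentum H)
    (hcoer : CoerciveInMomentum H) (hreg : UniformlyRegular H) (hμ : ∃ p, effectiveH H p < μ)
    (hd : IsAESubsolution H μ O d) (hdO : IsViscSupersolution H μ O d)
    (hV : CompactlyInside V U) (hVO : V ⊆ O) (hk : ∀ y ∈ frontier V, u y - d y ≤ k)
    {x : Space n} (hx : x ∈ V) : u x - d x ≤ k := by
  by_contra! hlt
  let W : Set (Space n) := V ∩ {y | k < u y - d y}
  have hcont : ContinuousOn (fun y => u y - d y) (closure V) :=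
    (hu.1.continuousOn.mono hV.2.2).sub hd.continuous.continuousOn
  have hWO : W ⊆ O := inter_subset_left.trans hVO
  have hW : CompactlyInside W U := hV.mono
    ((hcont.mono subset_closure).isOpen_inter_preimage hV.1 isOpen_Ioi) inter_subset_left
  have hWk : ∀ y ∈ frontier W, u y - d y = k := fun y =>
    eq_of_mem_frontier_inter_superlevel hV.1 hcont hk
  obtain ⟨g, hg, hug⟩ := hu.exists_isAESubsolution hW ((hd.mono hWO).add_const k)
    (fun y hy => by linarith [hy.2.out]) fun y hy => by linarith [hWk y hy]
  obtain ⟨p, hp⟩ := hμ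
  obtain ⟨μ₀, hμ₀, s, hs, -⟩ := exists_isAESubsolution_lt hcoer hreg hp 0
  have hbot : cocompact (Space n) ⊓ 𝓟 W = ⊥ := ((disjoint_cocompact_left _).2
    ⟨closure W, mem_principal.2 subset_closure, hW.2.1⟩).eq_bot
  have hle : g x - d x ≤ k :=
    hg.sub_le hconv hreg (hs.mono (subset_univ _)) hμ₀ hW.1 hd.continuous
      (hdO.mono hWO)
      (fun y hy => hug (frontier_subset_closure hy) ▸ (hWk y hy).le)
      ((hW.2.1.bddAbove_image (hs.continuous.sub hd.continuous).continuousOn).mono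
        (image_mono frontier_subset_closure))
      (isBoundedUnder_of_eventually_le (a := 0) (hbot ▸ eventually_bot))
      (hbot ▸ tendsto_bot) ⟨hx, hlt⟩
  exact hlt.not_ge (hug (subset_closure ⟨hx, hlt⟩) ▸ hle)

theorem comparisonFromAbove (hu : IsAbsSubminimizer H U u) (hconv : ConvexInMomentum H)
    (hcoer : CoerciveInMomentum H) (hreg : UniformlyRegular H) : ComparisonFromAbove H U u := by
  intro μ hμ V hV hVne x₀ hx₀
  have hμ' : ∃ p, effectiveH H p < μ := exists_lt_of_ciInf_lt hμ
  have hd : IsDistanceFunction H μ x₀ (distanceFunction H μ x₀) :=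
    Classical.epsilon_spec (existsUnique_isDistanceFunction hconv hcoer hreg hμ' x₀).exists
  have hcont : ContinuousOn (fun x => u x - distanceFunction H μ x₀ x) (closure V) :=
    (hu.1.continuousOn.mono hV.2.2).sub hd.continuous.continuousOn
  have hfrontier : (frontier V).Nonempty :=
    nonempty_frontier_iff.2 ⟨hVne, ne_univ_iff_exists_notMem V |>.2 ⟨x₀, hx₀⟩⟩
  obtain ⟨y, hy, hmax⟩ := (hV.2.1.of_isClosed_subset isClosed_frontier
    frontier_subset_closure).exists_isMaxOn hfrontier (hcont.mono frontier_subset_closure)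
  refine ⟨_, ⟨mem_image_of_mem _ (frontier_subset_closure hy), forall_mem_image.2 fun x hx => ?_⟩,
    mem_image_of_mem _ hy, forall_mem_image.2 fun x hx => hmax hx⟩
  by_cases hxV : x ∈ V
  · exact hu.sub_le hconv hcoer hreg hμ' (hd.isAESubsolution hcoer hreg) hd.isViscSolution.2 hV
      (subset_compl_singleton_iff.2 hx₀) (fun z hz => hmax hz) hxV
  · exact hmax (hV.1.frontier_eq ▸ ⟨hx, hxV⟩)

end IsAbsSubminimizer

end Comparison

end LInfVar

end

/-- The first conjunct says that the distance functions used in the second one are well defined. -/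
theorem proposition3p5 {n : ℕ} (hn : 1 ≤ n)
    (H : LInfVar.Space n → LInfVar.Space n → ℝ)
    (hconv : LInfVar.ConvexInMomentum H)
    (hcoer : LInfVar.CoerciveInMomentum H)
    (hreg : LInfVar.UniformlyRegular H)
    (U : Set (LInfVar.Space n)) (hU : IsOpen U)
    (u : LInfVar.Space n → ℝ) (hu : LInfVar.IsAbsSubminimizer H U u) :
    (∀ μ : ℝ, (⨅ p, LInfVar.effectiveH H p) < μ → ∀ x₀ : LInfVar.Space n,
      ∃! d : LInfVar.Space n → ℝ, LInfVar.IsDistanceFunction H μ x₀ d) ∧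
    LInfVar.ComparisonFromAbove H U u :=
  ⟨fun _ hμ x₀ => LInfVar.existsUnique_isDistanceFunction hconv hcoer hreg
      (exists_lt_of_ciInf_lt hμ) x₀,
    hu.comparisonFromAbove hconv hcoer hreg⟩
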